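/- Let $S=\mathbb{C}[x,y,z]$, let $S_m$ be the space of homogeneous polynomials of degree $m$ in $S$, and let $d\ge 1$ be an integer. Let $X(d)\subset \mathbb{P}(S_1)^d$ be the set of ordered $d$-tuples $(\ell_1,\dots,\ell_d)$ of pairwise distinct lines in $\mathbb{P}^2$ (so $\ell_i\neq \ell_j$ in $\mathbb{P}(S_1)$ for $i\ne j$), and let $A(d)\subset\mathbb{P}(S_d)$ be the set of arrangements of $d$ distinct lines, that is, the set of classes of the products $\ell_1\ell_2\cdots\ell_d$ with $(\ell_1,\dots,\ell_d)\in X(d)$. Then $A(d)$ and $X(d)$ are smooth, irreducible (quasi-projective) algebraic varieties of dimension $2d$. Moreover, for the classical complex topology, $X(d)$ is simply connected, and the fundamental group $\pi_1(A(d))$ (at any base point) is isomorphic to the symmetric group $\sigma_d$ on $d$ elements. -/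

import Mathlib

open scoped LinearAlgebra.Projectivization

noncomputable section

/-! ### Projective spaces: classical topology and multihomogeneous forms -/

/-- The classical (Euclidean) topology on the projective space of a complex vector space `E`: the
quotient topology from `E ∖ {0}`, where `E` carries its canonical vector space topology (for `E` of
finite dimension, the module topology is the usual topology of `ℂⁿ`). -/
instance projectivizationTopology (E : Type*) [AddCommGroup E] [Module ℂ E] :
    TopologicalSpace (ℙ ℂ E) :=
  TopologicalSpace.coinduced (fun v : {v : E // v ≠ 0} => Projectivization.mk ℂ v.1 v.2)
    (TopologicalSpace.induced Subtype.val (moduleTopology ℂ E))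

/-- The algebra of polynomial functions on a complex vector space: it is generated by the linear
functionals. -/
def polyFunctions (E : Type*) [AddCommGroup E] [Module ℂ E] : Subalgebra ℂ (E → ℂ) :=
  Algebra.adjoin ℂ (Set.range fun (l : Module.Dual ℂ E) (v : E) => l v)

/-- The homogeneous polynomial functions of degree `n` on `E`. -/
def homogFunctions (E : Type*) [AddCommGroup E] [Module ℂ E] (n : ℕ) :
    Submodule ℂ (E → ℂ) where
  carrier := {F | F ∈ polyFunctions E ∧ ∀ (c : ℂ) (v : E), F (c • v) = c ^ n * F v}
  add_mem' := by
    rintro F G ⟨hF, hF'⟩ ⟨hG, hG'⟩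
    refine ⟨add_mem hF hG, fun c v => ?_⟩
    simp only [Pi.add_apply, hF', hG']
    ring
  zero_mem' := ⟨zero_mem _, fun c v => by simp⟩
  smul_mem' := by
    rintro a F ⟨hF, hF'⟩
    refine ⟨Subalgebra.smul_mem _ hF a, fun c v => ?_⟩
    simp only [Pi.smul_apply, smul_eq_mul, hF']
    ring

/-- The multihomogeneous polynomial functions of multidegree `n` on `∏ i, E i`. -/
def multihomogFunctions {ι : Type*} [Fintype ι] (E : ι → Type*) [∀ i, AddCommGroup (E i)]
    [∀ i, Module ℂ (E i)] (n : ι → ℕ) : Submodule ℂ ((∀ i, E i) → ℂ) where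
  carrier := {F | F ∈ polyFunctions (∀ i, E i) ∧
    ∀ (c : ι → ℂ) (v : ∀ i, E i), F (fun i => c i • v i) = (∏ i, c i ^ n i) * F v}
  add_mem' := by
    rintro F G ⟨hF, hF'⟩ ⟨hG, hG'⟩
    refine ⟨add_mem hF hG, fun c v => ?_⟩
    simp only [Pi.add_apply, hF', hG']
    ring
  zero_mem' := ⟨zero_mem _, fun c v => by simp⟩
  smul_mem' := by
    rintro a F ⟨hF, hF'⟩
    refine ⟨Subalgebra.smul_mem _ hF a, fun c v => ?_⟩
    simp only [Pi.smul_apply, smul_eq_mul, hF']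
    ring

/-- The forms of degree `n` on the projective space `ℙ(E)`. A form is recorded through its values
at the chosen representatives of the points; only its zero set and the quotients `F / G` of two
forms of the same degree are used below, and these do not depend on the representatives. -/
def projForms (E : Type*) [AddCommGroup E] [Module ℂ E] (n : ℕ) : Submodule ℂ (ℙ ℂ E → ℂ) :=
  (homogFunctions E n).map (LinearMap.funLeft ℂ ℂ fun x : ℙ ℂ E => x.rep)

/-- The forms of multidegree `n` on the product of projective spaces `∏ i, ℙ(E i)`, recorded
through their values at the chosen representatives of the points. -/
def multiprojForms {ι : Type*} [Fintype ι] (E : ι → Type*) [∀ i, AddCommGroup (E i)]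
    [∀ i, Module ℂ (E i)] (n : ι → ℕ) : Submodule ℂ ((∀ i, ℙ ℂ (E i)) → ℂ) :=
  (multihomogFunctions E n).map
    (LinearMap.funLeft ℂ ℂ fun (x : ∀ i, ℙ ℂ (E i)) (i : ι) => (x i).rep)

instance projForms_gradedMonoid (E : Type*) [AddCommGroup E] [Module ℂ E] :
    SetLike.GradedMonoid (projForms E) where
  one_mem := ⟨1, ⟨one_mem _, fun c v => by simp⟩, rfl⟩
  mul_mem := by
    rintro m n _ _ ⟨F, ⟨hF, hF'⟩, rfl⟩ ⟨G, ⟨hG, hG'⟩, rfl⟩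
    refine ⟨F * G, ⟨mul_mem hF hG, fun c v => ?_⟩, rfl⟩
    simp only [Pi.mul_apply, hF', hG', pow_add]
    ring

instance multiprojForms_gradedMonoid {ι : Type*} [Fintype ι] (E : ι → Type*)
    [∀ i, AddCommGroup (E i)] [∀ i, Module ℂ (E i)] :
    SetLike.GradedMonoid (multiprojForms E) where
  one_mem := ⟨1, ⟨one_mem _, fun c v => by simp⟩, rfl⟩
  mul_mem := by
    rintro m n _ _ ⟨F, ⟨hF, hF'⟩, rfl⟩ ⟨G, ⟨hG, hG'⟩, rfl⟩
    refine ⟨F * G, ⟨mul_mem hF hG, fun c v => ?_⟩, rfl⟩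
    simp only [Pi.mul_apply, hF', hG', Pi.add_apply, pow_add, Finset.prod_mul_distrib]
    ring

/-! ### Zariski topology, local rings, smooth varieties

Here `W` is the set of points of a projective space or of a product of projective spaces, and
`𝓕 n` is the space of forms of (multi)degree `n` on it. -/

/-- The Zariski topology: the sets `{F ≠ 0}`, for `F` a form, are a basis of open sets. -/
@[reducible]
def zariskiTopology {W D : Type*} (𝓕 : D → Submodule ℂ (W → ℂ)) : TopologicalSpace W :=
  TopologicalSpace.generateFrom {U | ∃ n, ∃ F ∈ 𝓕 n, U = {x | F x ≠ 0}}

theorem zariski_eventually_ne {W D : Type*} {𝓕 : D → Submodule ℂ (W → ℂ)} (V : Set W) {p : W}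
    {n : D} {G : W → ℂ} (hG : G ∈ 𝓕 n) (hp : G p ≠ 0) :
    ∀ᶠ x in @nhdsWithin W (zariskiTopology 𝓕) p V, G x ≠ 0 := by
  let _ := zariskiTopology 𝓕
  apply mem_nhdsWithin_of_mem_nhds
  exact IsOpen.mem_nhds (TopologicalSpace.isOpen_generateFrom_of_mem ⟨n, G, hG, rfl⟩) hp

/-- The local ring `𝒪_{V,p}` of `V ⊆ W` at a point `p ∈ V`: the ring of germs at `p`, for the
Zariski topology of `V`, of functions `F / G` with `F, G` forms of the same degree and
`G p ≠ 0`. -/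
def localRingAt {W D : Type*} [AddMonoid D] (𝓕 : D → Submodule ℂ (W → ℂ))
    [SetLike.GradedMonoid 𝓕] (V : Set W) (p : W) :
    Subring (Filter.Germ (@nhdsWithin W (zariskiTopology 𝓕) p V) ℂ) where
  carrier := {φ | ∃ n, ∃ F ∈ 𝓕 n, ∃ G ∈ 𝓕 n, G p ≠ 0 ∧
    φ = Filter.Germ.ofFun (fun x => F x / G x)}
  zero_mem' := ⟨0, 0, zero_mem _, 1, SetLike.GradedOne.one_mem, by simp, by
    simp only [Pi.zero_apply, zero_div]; rfl⟩
  one_mem' := ⟨0, 1, SetLike.GradedOne.one_mem, 1, SetLike.GradedOne.one_mem, by simp, by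
    simp only [Pi.one_apply, div_one]; rfl⟩
  add_mem' := by
    rintro _ _ ⟨m, F, hF, G, hG, hGp, rfl⟩ ⟨n, F', hF', G', hG', hGp', rfl⟩
    refine ⟨m + n, F * G' + G * F',
      add_mem (SetLike.GradedMul.mul_mem hF hG') (SetLike.GradedMul.mul_mem hG hF'),
      G * G', SetLike.GradedMul.mul_mem hG hG', mul_ne_zero hGp hGp', ?_⟩
    refine Filter.Germ.coe_eq.2 ?_
    filter_upwards [zariski_eventually_ne V hG hGp, zariski_eventually_ne V hG' hGp'] with x h h'
    exact div_add_div _ _ h h'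
  mul_mem' := by
    rintro _ _ ⟨m, F, hF, G, hG, hGp, rfl⟩ ⟨n, F', hF', G', hG', hGp', rfl⟩
    refine ⟨m + n, F * F', SetLike.GradedMul.mul_mem hF hF', G * G',
      SetLike.GradedMul.mul_mem hG hG', mul_ne_zero hGp hGp', ?_⟩
    refine Filter.Germ.coe_eq.2 (Filter.Eventually.of_forall fun x => ?_)
    exact div_mul_div_comm _ _ _ _
  neg_mem' := by
    rintro _ ⟨m, F, hF, G, hG, hGp, rfl⟩
    refine ⟨m, -F, neg_mem hF, G, hG, hGp, ?_⟩
    refine Filter.Germ.coe_eq.2 (Filter.Eventually.of_forall fun x => ?_)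
    exact (neg_div _ _).symm

/-- `V ⊆ W` is a smooth irreducible (quasi-projective) algebraic variety of dimension `n`. -/
structure IsSmoothIrreducibleVariety {W D : Type*} [AddMonoid D] (𝓕 : D → Submodule ℂ (W → ℂ))
    [SetLike.GradedMonoid 𝓕] (V : Set W) (n : ℕ) : Prop where
  /-- `V` is locally closed in the Zariski topology. -/
  isLocallyClosed : @IsLocallyClosed W (zariskiTopology 𝓕) V
  /-- `V` is irreducible (in particular non-empty) in the Zariski topology. -/
  isIrreducible : @IsIrreducible W (zariskiTopology 𝓕) V
  /-- All local rings of `V` are regular. -/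
  isRegular : ∀ p ∈ V, IsRegularLocalRing (localRingAt 𝓕 V p)
  /-- The dimension of `V`, i.e. its Krull dimension in the Zariski topology, is `n`. -/
  dim_eq : @topologicalKrullDim V ((zariskiTopology 𝓕).induced Subtype.val) = n

/-! ### The parameter spaces of line arrangements -/

/-- `S_m`, the space of homogeneous polynomials of degree `m` in `ℂ[x, y, z]`. -/
abbrev ternaryForms (m : ℕ) : Submodule ℂ (MvPolynomial (Fin 3) ℂ) :=
  MvPolynomial.homogeneousSubmodule (Fin 3) ℂ m

/-- The product of `d` linear forms, as an element of `S_d`. -/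
def prodForms {d : ℕ} (l : Fin d → ternaryForms 1) : ternaryForms d :=
  ⟨∏ i, (l i : MvPolynomial (Fin 3) ℂ), by
    have h := MvPolynomial.IsHomogeneous.prod Finset.univ
      (fun i => (l i : MvPolynomial (Fin 3) ℂ)) (fun _ => 1) fun i _ => (l i).2
    simpa using h⟩

theorem prodForms_ne_zero {d : ℕ} {l : Fin d → ternaryForms 1} (hl : ∀ i, l i ≠ 0) :
    prodForms l ≠ 0 := by
  intro h
  have h' : ∏ i, (l i : MvPolynomial (Fin 3) ℂ) = 0 := congrArg Subtype.val h
  obtain ⟨i, -, hi⟩ := Finset.prod_eq_zero_iff.1 h'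
  exact hl i (Subtype.ext hi)

/-- The multiplication map `ℙ(S_1)^d → ℙ(S_d)`, `(ℓ_1, …, ℓ_d) ↦ ℓ_1 ⋯ ℓ_d`. -/
def lineProduct (d : ℕ) (l : Fin d → ℙ ℂ (ternaryForms 1)) : ℙ ℂ (ternaryForms d) :=
  Projectivization.mk ℂ (prodForms fun i => (l i).rep)
    (prodForms_ne_zero fun i => (l i).rep_nonzero)

/-- `lineProduct` does not depend on the choice of the representatives. -/
theorem lineProduct_mk {d : ℕ} (l : Fin d → ternaryForms 1) (hl : ∀ i, l i ≠ 0) :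
    lineProduct d (fun i => Projectivization.mk ℂ (l i) (hl i)) =
      Projectivization.mk ℂ (prodForms l) (prodForms_ne_zero hl) := by
  rw [lineProduct, Projectivization.mk_eq_mk_iff']
  choose a ha using fun i => Projectivization.exists_smul_eq_mk_rep ℂ (l i) (hl i)
  refine ⟨∏ i, (a i : ℂ), Subtype.ext ?_⟩
  simp only [prodForms, ← ha, Submodule.coe_smul, Units.smul_def, MvPolynomial.smul_eq_C_mul,
    Finset.prod_mul_distrib, map_prod]

/-- `A(d) ⊆ ℙ(S_d)`: the classes of the products of `d` pairwise distinct lines, i.e. the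
arrangements of `d` distinct lines in the projective plane. -/
def arrangementSpace (d : ℕ) : Set (ℙ ℂ (ternaryForms d)) :=
  {f | ∃ l : Fin d → ℙ ℂ (ternaryForms 1), Function.Injective l ∧ lineProduct d l = f}

/-- `X(d) ⊆ ℙ(S_1)^d`: the ordered `d`-tuples of pairwise distinct lines. -/
def orderedArrangementSpace (d : ℕ) : Set (Fin d → ℙ ℂ (ternaryForms 1)) :=
  {l | Function.Injective l}

theorem irreducible_rep (x : ℙ ℂ (ternaryForms 1)) :
    Irreducible (x.rep : MvPolynomial (Fin 3) ℂ) := by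
  have h0 : (x.rep : MvPolynomial (Fin 3) ℂ) ≠ 0 := fun h => x.rep_nonzero (Subtype.ext h)
  have hh : (x.rep : MvPolynomial (Fin 3) ℂ).IsHomogeneous 1 := x.rep.2
  refine MvPolynomial.irreducible_of_totalDegree_eq_one (hh.totalDegree h0) fun c hc => ?_
  obtain ⟨i, hi⟩ := MvPolynomial.ne_zero_iff.1 h0
  exact isUnit_iff_ne_zero.2 fun h => hi (zero_dvd_iff.1 (h ▸ hc i))

theorem eq_of_rep_dvd {x y : ℙ ℂ (ternaryForms 1)}
    (h : (x.rep : MvPolynomial (Fin 3) ℂ) ∣ y.rep) : x = y := by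
  obtain ⟨u, hu⟩ := (irreducible_rep x).associated_of_dvd (irreducible_rep y) h
  obtain ⟨c, -, hc⟩ := (MvPolynomial.isUnit_iff_eq_C_of_isReduced.1 u.isUnit)
  rw [← x.mk_rep, ← y.mk_rep, eq_comm, Projectivization.mk_eq_mk_iff']
  refine ⟨c, Subtype.ext ?_⟩
  rw [Submodule.coe_smul, MvPolynomial.smul_eq_C_mul, ← hc, ← hu, mul_comm]

/-- `X(d)` is the preimage of `A(d)` under the multiplication map. -/
theorem orderedArrangementSpace_eq_preimage (d : ℕ) :
    orderedArrangementSpace d = lineProduct d ⁻¹' arrangementSpace d := by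
  ext l
  refine ⟨fun h => ⟨l, h, rfl⟩, ?_⟩
  rintro ⟨m, hm, h⟩ i j hij
  by_contra hne
  rw [lineProduct, lineProduct, eq_comm, Projectivization.mk_eq_mk_iff] at h
  obtain ⟨a, ha⟩ := h
  have hsq : Squarefree (∏ k, ((m k).rep : MvPolynomial (Fin 3) ℂ)) :=
    Finset.squarefree_prod_of_pairwise_isCoprime
      (fun k _ k' _ hk => (irreducible_rep (m k)).isRelPrime_iff_not_dvd.2
        fun hd => hk (hm (eq_of_rep_dvd hd)))
      fun k _ => (irreducible_rep (m k)).squarefree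
  have hdvd : ((l i).rep : MvPolynomial (Fin 3) ℂ) * (l i).rep ∣
      ∏ k, ((l k).rep : MvPolynomial (Fin 3) ℂ) := by
    rw [← Finset.mul_prod_erase Finset.univ _ (Finset.mem_univ i)]
    refine mul_dvd_mul_left _ ?_
    have := Finset.dvd_prod_of_mem (fun k => ((l k).rep : MvPolynomial (Fin 3) ℂ))
      (Finset.mem_erase.2 ⟨Ne.symm hne, Finset.mem_univ j⟩ : j ∈ Finset.univ.erase i)
    rwa [← hij] at this
  have ha' : MvPolynomial.C (a : ℂ) * ∏ k, ((m k).rep : MvPolynomial (Fin 3) ℂ) =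
      ∏ k, ((l k).rep : MvPolynomial (Fin 3) ℂ) := by
    rw [← MvPolynomial.smul_eq_C_mul]
    exact congrArg Subtype.val ha
  rw [← ha'] at hdvd
  have hu : IsUnit (MvPolynomial.C (σ := Fin 3) (a : ℂ)) := a.isUnit.map MvPolynomial.C
  exact (irreducible_rep (l i)).not_isUnit (hsq _ (hu.dvd_mul_left.1 hdvd))

end

open scoped Topology

/-! ### Polynomials along a line -/

/-- A polynomial restricted to a line is a polynomial in the parameter. -/
theorem MvPolynomial.exists_eval_line {σ : Type*} (P : MvPolynomial σ ℂ) (t v : σ → ℂ) :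
    ∃ p : Polynomial ℂ, ∀ z : ℂ, MvPolynomial.eval (t + z • v) P = p.eval z := by
  refine ⟨MvPolynomial.aeval (fun i => Polynomial.C (t i) + Polynomial.X * Polynomial.C (v i)) P,
    fun z => ?_⟩
  rw [← Polynomial.coe_evalRingHom, MvPolynomial.aeval_def, MvPolynomial.hom_eval₂,
    MvPolynomial.eval, MvPolynomial.coe_eval₂Hom]
  congr 1
  · ext; simp
  · ext i
    simp only [Pi.add_apply, Pi.smul_apply, smul_eq_mul,
      Polynomial.coe_evalRingHom, Polynomial.eval_add, Polynomial.eval_C, Polynomial.eval_mul,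
      Polynomial.eval_X]

/-- A polynomial which does not vanish at some point of a line vanishes at finitely many points of
the line only. -/
theorem MvPolynomial.finite_line_zeros {σ : Type*} (P : MvPolynomial σ ℂ) (t v : σ → ℂ) (z₀ : ℂ)
    (h : MvPolynomial.eval (t + z₀ • v) P ≠ 0) :
    {z : ℂ | MvPolynomial.eval (t + z • v) P = 0}.Finite := by
  obtain ⟨p, hp⟩ := P.exists_eval_line t v
  simp only [hp] at h ⊢
  have h0 : p ≠ 0 := by rintro rfl; simp at h
  refine (p.roots.toFinset.finite_toSet).subset fun z hz => ?_
  simpa [h0] using hz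

/-! ### Charts of subsets of a space with forms -/

section Charts

set_option linter.unusedSectionVars false

variable {W D : Type*} [AddMonoid D] (𝓕 : D → Submodule ℂ (W → ℂ)) [SetLike.GradedMonoid 𝓕]

/-- `g` is a quotient of two forms of the same degree on `U`, the denominator being nowhere zero
on `U`. -/
def IsRegularFunOn (U : Set W) (g : W → ℂ) : Prop :=
  ∃ m, ∃ F ∈ 𝓕 m, ∃ G ∈ 𝓕 m, ∀ x ∈ U, G x ≠ 0 ∧ g x = F x / G x

variable {𝓕} {U V : Set W}

theorem isRegularFunOn_const (c : ℂ) : IsRegularFunOn 𝓕 U fun _ => c :=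
  ⟨0, c • 1, Submodule.smul_mem _ _ SetLike.GradedOne.one_mem, 1, SetLike.GradedOne.one_mem,
    fun x _ => by simp⟩

theorem IsRegularFunOn.add {f g : W → ℂ} (hf : IsRegularFunOn 𝓕 U f) (hg : IsRegularFunOn 𝓕 U g) :
    IsRegularFunOn 𝓕 U fun x => f x + g x := by
  obtain ⟨m, F, hF, G, hG, h⟩ := hf
  obtain ⟨n, F', hF', G', hG', h'⟩ := hg
  refine ⟨m + n, F * G' + G * F',
    add_mem (SetLike.GradedMul.mul_mem hF hG') (SetLike.GradedMul.mul_mem hG hF'),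
    G * G', SetLike.GradedMul.mul_mem hG hG', fun x hx => ?_⟩
  have h1 := h x hx
  have h2 := h' x hx
  refine ⟨mul_ne_zero h1.1 h2.1, ?_⟩
  change f x + g x = _
  rw [h1.2, h2.2]
  exact div_add_div _ _ h1.1 h2.1

theorem IsRegularFunOn.mul {f g : W → ℂ} (hf : IsRegularFunOn 𝓕 U f) (hg : IsRegularFunOn 𝓕 U g) :
    IsRegularFunOn 𝓕 U fun x => f x * g x := by
  obtain ⟨m, F, hF, G, hG, h⟩ := hf
  obtain ⟨n, F', hF', G', hG', h'⟩ := hg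
  refine ⟨m + n, F * F', SetLike.GradedMul.mul_mem hF hF', G * G',
    SetLike.GradedMul.mul_mem hG hG', fun x hx => ?_⟩
  have h1 := h x hx
  have h2 := h' x hx
  refine ⟨mul_ne_zero h1.1 h2.1, ?_⟩
  change f x * g x = _
  rw [h1.2, h2.2]
  exact div_mul_div_comm _ _ _ _

theorem IsRegularFunOn.eval {σ : Type*} {ψ : W → σ → ℂ}
    (hψ : ∀ i, IsRegularFunOn 𝓕 U fun x => ψ x i) (P : MvPolynomial σ ℂ) :
    IsRegularFunOn 𝓕 U fun x => MvPolynomial.eval (ψ x) P := by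
  induction P using MvPolynomial.induction_on with
  | C a => simpa using isRegularFunOn_const a
  | add p q hp hq => simpa using hp.add hq
  | mul_X p i hp => simpa using hp.mul (hψ i)

theorem isOpen_ne_zero_of_mem {m : D} {F : W → ℂ} (hF : F ∈ 𝓕 m) :
    IsOpen[zariskiTopology 𝓕] {x | F x ≠ 0} :=
  TopologicalSpace.isOpen_generateFrom_of_mem ⟨m, F, hF, rfl⟩

theorem IsRegularFunOn.isOpen_ne_zero {g : W → ℂ} (hg : IsRegularFunOn 𝓕 U g)
    (hU : IsOpen[zariskiTopology 𝓕] U) : IsOpen[zariskiTopology 𝓕] {x | x ∈ U ∧ g x ≠ 0} := by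
  obtain ⟨m, F, hF, G, hG, h⟩ := hg
  convert! @IsOpen.inter W (zariskiTopology 𝓕) U {x | F x ≠ 0} hU (isOpen_ne_zero_of_mem hF) using 1
  ext x
  refine and_congr_right fun hx => ?_
  rw [(h x hx).2]
  simp [(h x hx).1]

variable (𝓕) in
theorem isTopologicalBasis_zariski :
    @TopologicalSpace.IsTopologicalBasis W (zariskiTopology 𝓕)
      {U | ∃ n, ∃ F ∈ 𝓕 n, U = {x | F x ≠ 0}} := by
  let _ := zariskiTopology 𝓕
  refine TopologicalSpace.isTopologicalBasis_of_subbasis_of_finiteInter rfl ⟨?_, ?_⟩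
  · exact ⟨0, 1, SetLike.GradedOne.one_mem, by simp⟩
  · rintro _ ⟨m, F, hF, rfl⟩ _ ⟨n, G, hG, rfl⟩
    refine ⟨m + n, F * G, SetLike.GradedMul.mul_mem hF hG, ?_⟩
    ext x
    simp

/-- A rational chart of `V`: the coordinates `ψ` are regular on the open set `U`, and identify
the part of `V ∩ U` where `Δ ∘ ψ ≠ 0` with the principal open subset `Δ ≠ 0` of the affine
space `σ → ℂ`; up to a common factor, forms restrict to polynomials in the coordinates. -/
structure RationalChart (𝓕 : D → Submodule ℂ (W → ℂ)) (V U : Set W) {σ : Type*}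
    (ψ : W → σ → ℂ) (Δ : MvPolynomial σ ℂ) (φ : (σ → ℂ) → W) : Prop where
  isOpen : IsOpen[zariskiTopology 𝓕] U
  regular : ∀ i, IsRegularFunOn 𝓕 U fun x => ψ x i
  mapsTo : ∀ t, MvPolynomial.eval t Δ ≠ 0 → φ t ∈ V ∩ U
  right_inv : ∀ t, MvPolynomial.eval t Δ ≠ 0 → ψ (φ t) = t
  left_inv : ∀ x ∈ V ∩ U, MvPolynomial.eval (ψ x) Δ ≠ 0 → φ (ψ x) = x
  pullback : ∀ m, ∃ s : (σ → ℂ) → ℂ, (∀ t, MvPolynomial.eval t Δ ≠ 0 → s t ≠ 0) ∧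
    ∀ F ∈ 𝓕 m, ∃ P : MvPolynomial σ ℂ, ∀ t, MvPolynomial.eval t Δ ≠ 0 →
      F (φ t) = s t * MvPolynomial.eval t P

namespace RationalChart

variable {σ : Type*} {ψ : W → σ → ℂ} {Δ : MvPolynomial σ ℂ} {φ : (σ → ℂ) → W}
  (c : RationalChart 𝓕 V U ψ Δ φ)
include c

/-- The open set where the chart is defined. -/
theorem isOpen_domain : IsOpen[zariskiTopology 𝓕] {x | x ∈ U ∧ MvPolynomial.eval (ψ x) Δ ≠ 0} :=
  (IsRegularFunOn.eval c.regular Δ).isOpen_ne_zero c.isOpen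

theorem pullback' {m : D} : ∃ s : W → ℂ,
    (∀ x ∈ V ∩ U, MvPolynomial.eval (ψ x) Δ ≠ 0 → s x ≠ 0) ∧
    ∀ F ∈ 𝓕 m, ∃ P : MvPolynomial σ ℂ, ∀ x ∈ V ∩ U, MvPolynomial.eval (ψ x) Δ ≠ 0 →
      F x = s x * MvPolynomial.eval (ψ x) P := by
  obtain ⟨s, hs, h⟩ := c.pullback m
  refine ⟨fun x => s (ψ x), fun x _ hx => hs _ hx, fun F hF => ?_⟩
  obtain ⟨P, hP⟩ := h F hF
  refine ⟨P, fun x hx hx' => ?_⟩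
  rw [← hP _ hx', c.left_inv x hx hx']

/-- Regular functions on the affine space as germs on `V`. -/
theorem germ_mem {p : W} (hp : p ∈ U) (P : MvPolynomial σ ℂ) :
    (Filter.Germ.ofFun (fun x => MvPolynomial.eval (ψ x) P) :
      Filter.Germ (@nhdsWithin W (zariskiTopology 𝓕) p V) ℂ) ∈ localRingAt 𝓕 V p := by
  obtain ⟨m, F, hF, G, hG, h⟩ := IsRegularFunOn.eval c.regular P
  refine ⟨m, F, hF, G, hG, (h p hp).1, Filter.Germ.coe_eq.2 ?_⟩
  let _ := zariskiTopology 𝓕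
  filter_upwards [mem_nhdsWithin_of_mem_nhds (c.isOpen.mem_nhds hp)] with x hx
  exact (h x hx).2

theorem isRegularLocalRing [Finite σ] {p : W} (hpV : p ∈ V) (hp : p ∈ U)
    (hΔ : MvPolynomial.eval (ψ p) Δ ≠ 0) : IsRegularLocalRing (localRingAt 𝓕 V p) := by
  let top := zariskiTopology 𝓕
  let ev : MvPolynomial σ ℂ →+* (W → ℂ) := RingHom.pi fun x => MvPolynomial.eval (ψ x)
  let f : MvPolynomial σ ℂ →+* localRingAt 𝓕 V p :=
    ((Filter.Germ.coeRingHom (nhdsWithin p V)).comp ev).codRestrict (localRingAt 𝓕 V p)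
      (c.germ_mem hp)
  have hf : ∀ P, (f P : Filter.Germ (nhdsWithin p V) ℂ) =
      Filter.Germ.ofFun (fun x => MvPolynomial.eval (ψ x) P) := fun P => rfl
  let M : Ideal (MvPolynomial σ ℂ) := RingHom.ker (MvPolynomial.eval (ψ p))
  have hM : M.IsPrime := RingHom.ker_isPrime _
  have hMm : ∀ P, P ∈ M.primeCompl ↔ MvPolynomial.eval (ψ p) P ≠ 0 := fun P => by
    simp [M, Ideal.primeCompl, RingHom.mem_ker]
  let _ : Algebra (MvPolynomial σ ℂ) (localRingAt 𝓕 V p) := f.toAlgebra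
  have hdom : ∀ᶠ x in nhdsWithin p V, x ∈ V ∩ U ∧ MvPolynomial.eval (ψ x) Δ ≠ 0 := by
    filter_upwards [mem_nhdsWithin_of_mem_nhds (c.isOpen_domain.mem_nhds ⟨hp, hΔ⟩),
      self_mem_nhdsWithin] with x hx hxV using ⟨⟨hxV, hx.1⟩, hx.2⟩
  have loc : IsLocalization.AtPrime (localRingAt 𝓕 V p) M := by
    refine ⟨?_, ?_, ?_⟩
    · rintro ⟨P, hP⟩
      rw [hMm] at hP
      obtain ⟨m, F, hF, G, hG, h⟩ := IsRegularFunOn.eval c.regular P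
      beta_reduce at h
      have hFp : F p ≠ 0 := by
        rintro h0
        rw [(h p hp).2, h0, zero_div] at hP
        exact hP rfl
      refine IsUnit.of_mul_eq_one
        (⟨Filter.Germ.ofFun fun x => G x / F x, m, G, hG, F, hF, hFp, rfl⟩ : localRingAt 𝓕 V p) ?_
      refine Subtype.ext (Filter.Germ.coe_eq.2 ?_)
      filter_upwards [mem_nhdsWithin_of_mem_nhds (c.isOpen.mem_nhds hp),
        zariski_eventually_ne V hF hFp] with x hx hFx
      change MvPolynomial.eval (ψ x) P * (G x / F x) = 1
      rw [(h x hx).2]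
      have := (h x hx).1
      field_simp
    · rintro ⟨_, m, F, hF, G, hG, hGp, rfl⟩
      obtain ⟨s, hs, h⟩ := c.pullback' (m := m)
      obtain ⟨P, hP⟩ := h F hF
      obtain ⟨Q, hQ⟩ := h G hG
      have hQp : MvPolynomial.eval (ψ p) Q ≠ 0 := by
        intro h0
        rw [hQ p ⟨hpV, hp⟩ hΔ, h0, mul_zero] at hGp
        exact hGp rfl
      refine ⟨⟨P, ⟨Q, (hMm Q).2 hQp⟩⟩, Subtype.ext (Filter.Germ.coe_eq.2 ?_)⟩
      filter_upwards [hdom, zariski_eventually_ne V hG hGp] with x hx hGx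
      change F x / G x * MvPolynomial.eval (ψ x) Q = MvPolynomial.eval (ψ x) P
      have hsx := hs x hx.1 hx.2
      rw [hQ x hx.1 hx.2] at hGx ⊢
      rw [hP x hx.1 hx.2]
      have := right_ne_zero_of_mul hGx
      field_simp
    · intro P Q hPQ
      have hPQ' : ∀ᶠ x in nhdsWithin p V,
          MvPolynomial.eval (ψ x) P = MvPolynomial.eval (ψ x) Q :=
        Filter.Germ.coe_eq.1 (congrArg Subtype.val hPQ)
      obtain ⟨O, hO, hO'⟩ := mem_nhdsWithin_iff_exists_mem_nhds_inter.1 hPQ'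
      obtain ⟨_, ⟨m, H, hH, rfl⟩, hHp, hHO⟩ := (isTopologicalBasis_zariski 𝓕).mem_nhds_iff.1 hO
      obtain ⟨s, hs, h⟩ := c.pullback m
      obtain ⟨R, hR⟩ := h H hH
      have hRp : MvPolynomial.eval (ψ p) R ≠ 0 := by
        intro h0
        have := hR (ψ p) hΔ
        rw [h0, mul_zero, c.left_inv p ⟨hpV, hp⟩ hΔ] at this
        exact hHp this
      refine ⟨⟨Δ * R, (hMm _).2 ?_⟩, MvPolynomial.funext fun t => ?_⟩
      · rw [map_mul]
        exact mul_ne_zero hΔ hRp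
      · simp only [map_mul]
        by_cases h1 : MvPolynomial.eval t Δ = 0
        · simp [h1]
        by_cases h2 : MvPolynomial.eval t R = 0
        · simp [h2]
        have : MvPolynomial.eval (ψ (φ t)) P = MvPolynomial.eval (ψ (φ t)) Q := by
          refine hO' ⟨hHO ?_, (c.mapsTo t h1).1⟩
          change H (φ t) ≠ 0
          rw [hR t h1]
          exact mul_ne_zero (hs t h1) h2
        rw [c.right_inv t h1] at this
        rw [this]
  exact IsRegularLocalRing.of_ringEquiv
    (IsLocalization.algEquiv M.primeCompl (Localization.AtPrime M)
      (localRingAt 𝓕 V p)).toRingEquiv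


/-- Generic points of the line through two points of a chart avoid the zeros of given forms. -/
theorem exists_line_ne_zero {x y : W} (hx : x ∈ V ∩ U) (hxΔ : MvPolynomial.eval (ψ x) Δ ≠ 0)
    (hy : y ∈ V ∩ U) (hyΔ : MvPolynomial.eval (ψ y) Δ ≠ 0) {m n : D} {F G : W → ℂ}
    (hF : F ∈ 𝓕 m) (hG : G ∈ 𝓕 n) (hFx : F x ≠ 0) (hGy : G y ≠ 0) :
    ∃ z : ℂ, MvPolynomial.eval (ψ x + z • (ψ y - ψ x)) Δ ≠ 0 ∧
      F (φ (ψ x + z • (ψ y - ψ x))) ≠ 0 ∧ G (φ (ψ x + z • (ψ y - ψ x))) ≠ 0 := by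
  obtain ⟨s, hs, h⟩ := c.pullback m
  obtain ⟨P, hP⟩ := h F hF
  obtain ⟨s', hs', h'⟩ := c.pullback n
  obtain ⟨Q, hQ⟩ := h' G hG
  have hPx : MvPolynomial.eval (ψ x) P ≠ 0 := by
    intro h0
    have := hP _ hxΔ
    rw [h0, mul_zero, c.left_inv x hx hxΔ] at this
    exact hFx this
  have hQy : MvPolynomial.eval (ψ y) Q ≠ 0 := by
    intro h0
    have := hQ _ hyΔ
    rw [h0, mul_zero, c.left_inv y hy hyΔ] at this
    exact hGy this
  have f1 := Δ.finite_line_zeros (ψ x) (ψ y - ψ x) 0 (by simpa using hxΔ)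
  have f2 := P.finite_line_zeros (ψ x) (ψ y - ψ x) 0 (by simpa using hPx)
  have f3 := Q.finite_line_zeros (ψ x) (ψ y - ψ x) 1 (by simpa using hQy)
  obtain ⟨z, hz⟩ := ((f1.union f2).union f3).infinite_compl.nonempty
  simp only [Set.mem_compl_iff, Set.mem_union, Set.mem_ofPred_eq, not_or] at hz
  refine ⟨z, hz.1.1, ?_, ?_⟩
  · rw [hP _ hz.1.1]
    exact mul_ne_zero (hs _ hz.1.1) hz.1.2
  · rw [hQ _ hz.1.1]
    exact mul_ne_zero (hs' _ hz.1.1) hz.2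

/-- If forms separate points, `V` is closed in `U`, away from the zeros of `Δ`. -/
theorem mem_of_mem_closure
    (hsep : ∀ x y : W, (∀ m, ∀ F ∈ 𝓕 m, ∀ G ∈ 𝓕 m, F x * G y = F y * G x) → x = y)
    {x : W} (hxU : x ∈ U) (hxΔ : MvPolynomial.eval (ψ x) Δ ≠ 0)
    (hx : x ∈ closure[zariskiTopology 𝓕] V) : x ∈ V := by
  suffices h : φ (ψ x) = x by
    rw [← h]
    exact (c.mapsTo _ hxΔ).1
  let _ := zariskiTopology 𝓕
  refine hsep _ _ fun m F hF G hG => ?_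
  obtain ⟨s, hs, h⟩ := c.pullback m
  obtain ⟨P, hP⟩ := h F hF
  obtain ⟨Q, hQ⟩ := h G hG
  obtain ⟨n, A, hA, B, hB, hAB⟩ := IsRegularFunOn.eval c.regular P
  obtain ⟨n', A', hA', B', hB', hAB'⟩ := IsRegularFunOn.eval c.regular Q
  beta_reduce at hAB hAB'
  have hmem : A * B' * G - B * A' * F ∈ 𝓕 (n + n' + m) :=
    sub_mem (SetLike.GradedMul.mul_mem (SetLike.GradedMul.mul_mem hA hB') hG)
      (SetLike.GradedMul.mul_mem (SetLike.GradedMul.mul_mem hB hA') hF)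
  have key : ∀ y ∈ U, (A * B' * G - B * A' * F) y = 0 ↔
      MvPolynomial.eval (ψ y) P * G y = F y * MvPolynomial.eval (ψ y) Q := by
    intro y hy
    rw [(hAB y hy).2, (hAB' y hy).2]
    have h1 := (hAB y hy).1
    have h2 := (hAB' y hy).1
    simp only [Pi.sub_apply, Pi.mul_apply, sub_eq_zero]
    field_simp
  have hzero : (A * B' * G - B * A' * F) x = 0 := by
    by_contra h0
    obtain ⟨y, ⟨⟨hyU, hyΔ⟩, hy0⟩, hyV⟩ := mem_closure_iff.1 hx _
      (c.isOpen_domain.inter (isOpen_ne_zero_of_mem hmem)) ⟨⟨hxU, hxΔ⟩, h0⟩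
    refine hy0 ((key y hyU).2 ?_)
    have e1 := hP _ hyΔ
    have e2 := hQ _ hyΔ
    rw [c.left_inv y ⟨hyV, hyU⟩ hyΔ] at e1 e2
    rw [e1, e2]
    ring
  rw [hP _ hxΔ, hQ _ hxΔ]
  linear_combination s (ψ x) * (key x hxU).1 hzero

/-- The open subset of `V` where the chart is defined. -/
def domain (_ : RationalChart 𝓕 V U ψ Δ φ) : Set V :=
  {x | (x : W) ∈ U ∧ MvPolynomial.eval (ψ x) Δ ≠ 0}

theorem topologicalKrullDim_domain_le [Finite σ] :
    letI := zariskiTopology 𝓕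
    topologicalKrullDim c.domain ≤ (Nat.card σ : ℕ) := by
  let _ := zariskiTopology 𝓕
  let g : c.domain → PrimeSpectrum (MvPolynomial σ ℂ) :=
    fun x => MvPolynomial.pointToPoint (ψ x.1)
  have hg : ∀ (P : MvPolynomial σ ℂ) (x : c.domain),
      g x ∈ PrimeSpectrum.basicOpen P ↔ MvPolynomial.eval (ψ x.1) P ≠ 0 := by
    intro P x
    simp only [g, PrimeSpectrum.mem_basicOpen, MvPolynomial.pointToPoint,
      MvPolynomial.mem_vanishingIdeal_singleton_iff, ne_eq]
    rfl
  have cont : Continuous g := by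
    refine PrimeSpectrum.isTopologicalBasis_basic_opens.continuous_iff.2 ?_
    rintro _ ⟨P, rfl⟩
    refine isOpen_induced_iff.2 ⟨Subtype.val ⁻¹' {x | x ∈ U ∧ MvPolynomial.eval (ψ x) P ≠ 0},
      ((IsRegularFunOn.eval c.regular P).isOpen_ne_zero c.isOpen).preimage continuous_subtype_val,
      ?_⟩
    ext x
    change (_ ∧ _) ↔ g x ∈ PrimeSpectrum.basicOpen P
    rw [hg]
    exact and_iff_right x.2.1
  have ind : Topology.IsInducing g := by
    refine Topology.isInducing_iff_nhds.2 fun x => le_antisymm cont.continuousAt.le_comap ?_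
    intro N hN
    rw [nhds_subtype, nhds_subtype, Filter.comap_comap] at hN
    obtain ⟨N', hN', hN⟩ := hN
    obtain ⟨_, ⟨m, H, hH, rfl⟩, hHp, hHO⟩ := (isTopologicalBasis_zariski 𝓕).mem_nhds_iff.1 hN'
    obtain ⟨s, hs, h⟩ := c.pullback' (m := m)
    obtain ⟨P, hP⟩ := h H hH
    refine ⟨PrimeSpectrum.basicOpen P, (PrimeSpectrum.basicOpen P).isOpen.mem_nhds ?_, ?_⟩
    · refine (hg P x).2 fun h0 => hHp ?_
      rw [hP _ ⟨x.1.2, x.2.1⟩ x.2.2, h0, mul_zero]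
    · intro y hy
      refine hN (hHO ?_)
      change H y.1 ≠ 0
      rw [hP _ ⟨y.1.2, y.2.1⟩ y.2.2]
      exact mul_ne_zero (hs _ ⟨y.1.2, y.2.1⟩ y.2.2) ((hg P y).1 hy)
  refine ind.topologicalKrullDim_le.trans ?_
  rw [PrimeSpectrum.topologicalKrullDim_eq_ringKrullDim,
    MvPolynomial.ringKrullDim_of_isNoetherianRing, ringKrullDim_eq_zero_of_field, zero_add]

/-- The coordinate subspaces through a point of a chart. -/
theorem isIrreducible_coordinateSubspace (p : c.domain) (S : Set σ) :
    letI := zariskiTopology 𝓕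
    IsIrreducible {x : c.domain | ∀ i ∈ S, ψ x.1 i = ψ p.1 i} ∧
      IsClosed {x : c.domain | ∀ i ∈ S, ψ x.1 i = ψ p.1 i} := by
  let _ := zariskiTopology 𝓕
  refine ⟨⟨⟨p, fun i _ => rfl⟩, ?_⟩, ?_⟩
  · rintro _ _ ⟨_, ⟨u, hu, rfl⟩, rfl⟩ ⟨_, ⟨v, hv, rfl⟩, rfl⟩ ⟨x, hx, hxu⟩ ⟨y, hy, hyv⟩
    obtain ⟨_, ⟨m, F, hF, rfl⟩, hFx, hFu⟩ :=
      (isTopologicalBasis_zariski 𝓕).mem_nhds_iff.1 (hu.mem_nhds hxu)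
    obtain ⟨_, ⟨n, G, hG, rfl⟩, hGy, hGv⟩ :=
      (isTopologicalBasis_zariski 𝓕).mem_nhds_iff.1 (hv.mem_nhds hyv)
    obtain ⟨z, hz, hzF, hzG⟩ := c.exists_line_ne_zero ⟨x.1.2, x.2.1⟩ x.2.2 ⟨y.1.2, y.2.1⟩ y.2.2
      hF hG hFx hGy
    have hmem := c.mapsTo _ hz
    have hr := c.right_inv _ hz
    refine ⟨⟨⟨_, hmem.1⟩, hmem.2, ?_⟩, fun i hi => ?_, hFu hzF, hGv hzG⟩
    · rw [hr]
      exact hz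
    · dsimp only
      rw [hr]
      simp [hx i hi, hy i hi]
  · rw [Set.ofPred_forall]
    refine isClosed_iInter fun i => ?_
    rw [Set.ofPred_forall]
    refine isClosed_iInter fun _ => ⟨?_⟩
    refine isOpen_induced_iff.2 ⟨Subtype.val ⁻¹' {x | x ∈ U ∧ ψ x i + - ψ p.1 i ≠ 0},
      (((c.regular i).add (isRegularFunOn_const (- ψ p.1 i))).isOpen_ne_zero c.isOpen).preimage
        continuous_subtype_val, ?_⟩
    ext x
    have := x.2.1
    simp [← sub_eq_add_neg, sub_eq_zero, this]

theorem le_topologicalKrullDim_domain [Finite σ] (p : c.domain) :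
    letI := zariskiTopology 𝓕
    (Nat.card σ : ℕ) ≤ topologicalKrullDim c.domain := by
  let _ := zariskiTopology 𝓕
  let e : σ ≃ Fin (Nat.card σ) := Finite.equivFin σ
  let Z : Fin (Nat.card σ + 1) → TopologicalSpace.IrreducibleCloseds c.domain := fun k =>
    ⟨_, (c.isIrreducible_coordinateSubspace p {i | (k : ℕ) ≤ e i}).1,
      (c.isIrreducible_coordinateSubspace p {i | (k : ℕ) ≤ e i}).2⟩
  have hZ : ∀ k (x : c.domain), x ∈ (Z k : Set c.domain) ↔
      ∀ i, (k : ℕ) ≤ e i → ψ x.1 i = ψ p.1 i := fun k x => Iff.rfl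
  have hmono : StrictMono Z := by
    refine Fin.strictMono_iff_lt_succ.2 fun k => SetLike.coe_ssubset_coe.1 ?_
    refine Set.ssubset_iff_subset_ne.2 ⟨fun x hx => ?_, fun heq => ?_⟩
    · rw [hZ] at hx ⊢
      exact fun i hi => hx i (by simp at hi ⊢; omega)
    · classical
      have fin := Δ.finite_line_zeros (ψ p.1) (Pi.single (e.symm k) 1) 0 (by simpa using p.2.2)
      obtain ⟨z, hz⟩ := (fin.union (Set.finite_singleton 0)).infinite_compl.nonempty
      simp only [Set.mem_compl_iff, Set.mem_union, Set.mem_ofPred_eq, not_or,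
        Set.mem_singleton_iff] at hz
      have hmem := c.mapsTo _ hz.1
      have hr := c.right_inv _ hz.1
      let y : c.domain := ⟨⟨_, hmem.1⟩, hmem.2, by rw [hr]; exact hz.1⟩
      have hy : ψ y.1 = ψ p.1 + z • Pi.single (e.symm k) 1 := hr
      have hy1 : y ∈ (Z k.succ : Set c.domain) := by
        rw [hZ]
        intro i hi
        have : i ≠ e.symm k := by
          rintro rfl
          simp at hi
        simp [hy, this]
      rw [← heq, hZ] at hy1
      have := hy1 (e.symm k) (by simp)
      simp [hy, hz.2] at this
  exact Order.LTSeries.length_le_krullDim (LTSeries.mk _ Z hmono)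

end RationalChart

theorem topologicalKrullDim_le_of_open_cover {X : Type*} [TopologicalSpace X] {n : WithBot ℕ∞}
    (h : ∀ x : X, ∃ O : Set X, IsOpen O ∧ x ∈ O ∧ topologicalKrullDim O ≤ n) :
    topologicalKrullDim X ≤ n := by
  rw [topologicalKrullDim, Order.krullDim_eq_iSup_coheight]
  refine iSup_le fun Z => ?_
  obtain ⟨x, hx⟩ := Z.isIrreducible.nonempty
  obtain ⟨O, hO, hxO, hn⟩ := h x
  let Z' := (TopologicalSpace.IrreducibleCloseds.orderIsoOfIsOpenEmbedding _
    hO.isOpenEmbedding_subtypeVal).symm ⟨Z, ⟨⟨x, hxO⟩, hx⟩⟩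
  have hZ' : TopologicalSpace.IrreducibleCloseds.map _
      hO.isOpenEmbedding_subtypeVal.continuous Z' = Z :=
    congrArg Subtype.val ((TopologicalSpace.IrreducibleCloseds.orderIsoOfIsOpenEmbedding _
      hO.isOpenEmbedding_subtypeVal).apply_symm_apply ⟨Z, ⟨⟨x, hxO⟩, hx⟩⟩)
  rw [← hZ', hO.isOpenEmbedding_subtypeVal.coheight_map]
  exact (Order.coheight_le_krullDim Z').trans hn

variable (𝓕 V) in
/-- A nonempty subset, any two points of which lie in a common chart modelled on the affine space
of dimension `n`, is a smooth irreducible variety of dimension `n`. -/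
theorem isSmoothIrreducibleVariety_of_charts {σ : Type*} [Finite σ] (hV : V.Nonempty)
    (hsep : ∀ x y : W, (∀ m, ∀ F ∈ 𝓕 m, ∀ G ∈ 𝓕 m, F x * G y = F y * G x) → x = y)
    (h : ∀ x ∈ V, ∀ y ∈ V, ∃ (U : Set W) (ψ : W → σ → ℂ) (Δ : MvPolynomial σ ℂ)
      (φ : (σ → ℂ) → W), RationalChart 𝓕 V U ψ Δ φ ∧
      (x ∈ U ∧ MvPolynomial.eval (ψ x) Δ ≠ 0) ∧ y ∈ U ∧ MvPolynomial.eval (ψ y) Δ ≠ 0) :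
    IsSmoothIrreducibleVariety 𝓕 V (Nat.card σ) := by
  let _ := zariskiTopology 𝓕
  constructor
  · refine ((isLocallyClosed_tfae V).out 0 3).2 fun x hx => ?_
    obtain ⟨U, ψ, Δ, φ, c, hxU, -⟩ := h x hx x hx
    exact ⟨_, hxU, c.isOpen_domain, fun y hy => c.mem_of_mem_closure hsep hy.1.1 hy.1.2 hy.2⟩
  · refine ⟨hV, ?_⟩
    rintro u v hu hv ⟨x, hx, hxu⟩ ⟨y, hy, hyv⟩
    obtain ⟨U, ψ, Δ, φ, c, hxU, hyU⟩ := h x hx y hy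
    obtain ⟨_, ⟨m, F, hF, rfl⟩, hFx, hFu⟩ :=
      (isTopologicalBasis_zariski 𝓕).mem_nhds_iff.1 (hu.mem_nhds hxu)
    obtain ⟨_, ⟨n, G, hG, rfl⟩, hGy, hGv⟩ :=
      (isTopologicalBasis_zariski 𝓕).mem_nhds_iff.1 (hv.mem_nhds hyv)
    obtain ⟨z, hz, hzF, hzG⟩ := c.exists_line_ne_zero ⟨hx, hxU.1⟩ hxU.2 ⟨hy, hyU.1⟩ hyU.2
      hF hG hFx hGy
    exact ⟨_, (c.mapsTo _ hz).1, hFu hzF, hGv hzG⟩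
  · intro p hp
    obtain ⟨U, ψ, Δ, φ, c, hpU, -⟩ := h p hp p hp
    exact c.isRegularLocalRing hp hpU.1 hpU.2
  · refine le_antisymm (topologicalKrullDim_le_of_open_cover fun x => ?_) ?_
    · obtain ⟨U, ψ, Δ, φ, c, hxU, -⟩ := h x x.2 x x.2
      exact ⟨c.domain, c.isOpen_domain.preimage continuous_subtype_val, hxU,
        c.topologicalKrullDim_domain_le⟩
    · obtain ⟨x, hx⟩ := hV
      obtain ⟨U, ψ, Δ, φ, c, hxU, -⟩ := h x hx x hx
      exact (c.le_topologicalKrullDim_domain ⟨⟨x, hx⟩, hxU⟩).trans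
        (topologicalKrullDim_subspace_le _ _)

end Charts

/-! ### Polynomial functions and forms -/

section Forms

variable {E : Type*} [AddCommGroup E] [Module ℂ E]

/-- Polynomial functions pull back to polynomials along a map with polynomial coordinates. -/
theorem exists_eval_eq_of_mem_polyFunctions {σ : Type*} {T : Set (σ → ℂ)} {g : (σ → ℂ) → E}
    (hg : ∀ l : Module.Dual ℂ E, ∃ P : MvPolynomial σ ℂ, ∀ t ∈ T, l (g t) = MvPolynomial.eval t P)
    {F : E → ℂ} (hF : F ∈ polyFunctions E) :
    ∃ P : MvPolynomial σ ℂ, ∀ t ∈ T, F (g t) = MvPolynomial.eval t P := by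
  induction hF using Algebra.adjoin_induction with
  | mem F hF =>
    obtain ⟨l, rfl⟩ := hF
    exact hg l
  | algebraMap r => exact ⟨MvPolynomial.C r, fun t _ => by simp⟩
  | add F G _ _ hF hG =>
    obtain ⟨P, hP⟩ := hF
    obtain ⟨Q, hQ⟩ := hG
    exact ⟨P + Q, fun t ht => by simp [hP t ht, hQ t ht]⟩
  | mul F G _ _ hF hG =>
    obtain ⟨P, hP⟩ := hF
    obtain ⟨Q, hQ⟩ := hG
    exact ⟨P * Q, fun t ht => by simp [hP t ht, hQ t ht]⟩

theorem dual_mem_projForms (l : Module.Dual ℂ E) : (fun x : ℙ ℂ E => l x.rep) ∈ projForms E 1 :=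
  ⟨l, ⟨Algebra.subset_adjoin ⟨l, rfl⟩, fun c v => by simp⟩, rfl⟩

theorem dual_mem_multiprojForms {ι : Type*} [Fintype ι] [DecidableEq ι] (i : ι)
    (l : Module.Dual ℂ E) :
    (fun x : ι → ℙ ℂ E => l (x i).rep) ∈ multiprojForms (fun _ : ι => E) (Pi.single i 1) := by
  refine ⟨fun v => l (v i), ⟨Algebra.subset_adjoin ⟨l ∘ₗ LinearMap.proj i, rfl⟩, fun c v => ?_⟩,
    rfl⟩
  rw [Finset.prod_eq_single i (fun j _ hj => by simp [hj]) (by simp)]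
  simp

theorem exists_dual_ne_zero {v : E} (hv : v ≠ 0) : ∃ l : Module.Dual ℂ E, l v ≠ 0 := by
  by_contra! h
  exact hv ((Module.forall_dual_apply_eq_zero_iff ℂ v).1 h)

theorem projectivization_eq_of_dual {x y : ℙ ℂ E}
    (h : ∀ l k : Module.Dual ℂ E, l x.rep * k y.rep = l y.rep * k x.rep) : x = y := by
  obtain ⟨k, hk⟩ := exists_dual_ne_zero x.rep_nonzero
  rw [← x.mk_rep, ← y.mk_rep, eq_comm, Projectivization.mk_eq_mk_iff']
  refine ⟨k y.rep / k x.rep, sub_eq_zero.1 ((Module.forall_dual_apply_eq_zero_iff ℂ _).1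
    fun l => ?_)⟩
  rw [map_sub, map_smul, smul_eq_mul, sub_eq_zero]
  field_simp
  linear_combination h l k

theorem projForms_separate {x y : ℙ ℂ E}
    (h : ∀ m, ∀ F ∈ projForms E m, ∀ G ∈ projForms E m, F x * G y = F y * G x) : x = y :=
  projectivization_eq_of_dual fun l k =>
    h 1 _ (dual_mem_projForms l) _ (dual_mem_projForms k)

theorem multiprojForms_separate {ι : Type*} [Fintype ι] {x y : ι → ℙ ℂ E}
    (h : ∀ m, ∀ F ∈ multiprojForms (fun _ : ι => E) m, ∀ G ∈ multiprojForms (fun _ : ι => E) m,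
      F x * G y = F y * G x) : x = y := by
  classical
  exact funext fun i => projectivization_eq_of_dual fun l k =>
    h _ _ (dual_mem_multiprojForms i l) _ (dual_mem_multiprojForms i k)

/-- The representative of a point is a multiple of any vector defining it. -/
theorem exists_rep_mk_eq_smul (v : E) (hv : v ≠ 0) :
    ∃ c : ℂ, c ≠ 0 ∧ (Projectivization.mk ℂ v hv).rep = c • v := by
  obtain ⟨a, ha⟩ := Projectivization.exists_smul_eq_mk_rep ℂ v hv
  exact ⟨a, a.ne_zero, ha.symm⟩

end Forms

/-! ### Linear forms in three variables -/

/-- The linear form with given coefficients. -/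
noncomputable def linForm : (Fin 3 → ℂ) ≃ₗ[ℂ] ternaryForms 1 where
  toFun c := ⟨∑ i, MvPolynomial.C (c i) * MvPolynomial.X i,
    sum_mem fun i _ => MvPolynomial.isHomogeneous_C_mul_X _ i⟩
  map_add' c c' := Subtype.ext (by simp [add_mul, Finset.sum_add_distrib])
  map_smul' a c := Subtype.ext (by
    simp [MvPolynomial.smul_eq_C_mul, Finset.mul_sum, mul_assoc])
  invFun l i := MvPolynomial.coeff (Finsupp.single i 1) (l : MvPolynomial (Fin 3) ℂ)
  left_inv c := by
    ext i
    simp [MvPolynomial.coeff_sum, MvPolynomial.coeff_C_mul, MvPolynomial.coeff_X,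
      Finsupp.single_left_inj]
  right_inv l := by
    refine Subtype.ext (MvPolynomial.ext _ _ fun m => ?_)
    by_cases hm : m.degree = 1
    · obtain ⟨i, rfl⟩ : ∃ i, m = Finsupp.single i 1 := by
        obtain ⟨i, hi⟩ := (Finsupp.range_single_one (σ := Fin 3)).ge hm
        exact ⟨i, hi.symm⟩
      simp [MvPolynomial.coeff_sum, MvPolynomial.coeff_C_mul, MvPolynomial.coeff_X,
        Finsupp.single_left_inj]
    · rw [l.2.coeff_eq_zero hm]
      refine MvPolynomial.IsHomogeneous.coeff_eq_zero (n := 1) ?_ hm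
      exact MvPolynomial.IsHomogeneous.sum _ _ _ fun i _ =>
        MvPolynomial.isHomogeneous_C_mul_X _ i

theorem coe_linForm (c : Fin 3 → ℂ) : (linForm c : MvPolynomial (Fin 3) ℂ) =
    ∑ i, MvPolynomial.C (c i) * MvPolynomial.X i := rfl

theorem eval_linForm (c p : Fin 3 → ℂ) :
    MvPolynomial.eval p (linForm c : MvPolynomial (Fin 3) ℂ) = ∑ i, c i * p i := by
  simp [coe_linForm]

theorem dual_eq_sum (l : Module.Dual ℂ (ternaryForms 1)) (f : ternaryForms 1) :
    l f = ∑ i, linForm.symm f i * l (linForm (Pi.single i 1)) := by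
  obtain ⟨c, rfl⟩ := linForm.surjective f
  rw [LinearEquiv.symm_apply_apply]
  conv_lhs => rw [pi_eq_sum_univ' c]
  simp only [map_sum, map_smul, smul_eq_mul]

theorem minors_eq {a b : Fin 3 → ℂ} (h10 : a 1 * b 0 = b 1 * a 0) (h12 : a 1 * b 2 = b 1 * a 2)
    (h20 : a 2 * b 0 = b 2 * a 0) (i j : Fin 3) : a i * b j = b i * a j := by
  fin_cases i <;> fin_cases j <;> simp only [Fin.zero_eta, Fin.mk_one, Fin.reduceFinMk] <;>
    first
      | exact mul_comm _ _
      | assumption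
      | linear_combination -h10
      | linear_combination -h12
      | linear_combination -h20

/-- A unipotent change of coordinates in the space of linear forms. -/
def shear (p q r : ℂ) : (Fin 3 → ℂ) ≃ₗ[ℂ] (Fin 3 → ℂ) where
  toFun c := ![c 0 + c 1 * p + c 2 * q, c 1 + c 2 * r, c 2]
  map_add' c c' := by ext i; fin_cases i <;> simp <;> ring
  map_smul' a c := by ext i; fin_cases i <;> simp <;> ring
  invFun c := ![c 0 - (c 1 - c 2 * r) * p - c 2 * q, c 1 - c 2 * r, c 2]
  left_inv c := by ext i; fin_cases i <;> simp; ring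
  right_inv c := by ext i; fin_cases i <;> simp; ring

/-- Coordinates on the space of linear forms given by the values at three points `w, u, v`. -/
structure IsFrame (w u v : Fin 3 → ℂ) (L : ternaryForms 1 ≃ₗ[ℂ] (Fin 3 → ℂ)) : Prop where
  eval_zero : ∀ l : ternaryForms 1, MvPolynomial.eval w (l : MvPolynomial (Fin 3) ℂ) = L l 0
  eval_one : ∀ l : ternaryForms 1, MvPolynomial.eval u (l : MvPolynomial (Fin 3) ℂ) = L l 1
  eval_two : ∀ l : ternaryForms 1, MvPolynomial.eval v (l : MvPolynomial (Fin 3) ℂ) = L l 2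

/-- There are coordinates in general position with respect to finitely many lines. -/
theorem exists_frame (s : Finset (ℙ ℂ (ternaryForms 1))) :
    ∃ (w u v : Fin 3 → ℂ) (L : ternaryForms 1 ≃ₗ[ℂ] (Fin 3 → ℂ)), IsFrame w u v L ∧
      (∀ x ∈ s, L x.rep 0 ≠ 0) ∧
      ∀ x ∈ s, ∀ y ∈ s, x ≠ y → L x.rep 1 * L y.rep 0 ≠ L y.rep 1 * L x.rep 0 := by
  classical
  let κ : ℙ ℂ (ternaryForms 1) → Fin 3 → ℂ := fun x => linForm.symm x.rep
  have hκ0 : ∀ x, κ x ≠ 0 := fun x h => x.rep_nonzero (by simpa [κ] using h)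
  let N : ℙ ℂ (ternaryForms 1) → MvPolynomial (Fin 3) ℂ := fun x =>
    MvPolynomial.C (κ x 0) + MvPolynomial.C (κ x 1) * MvPolynomial.X 0 +
      MvPolynomial.C (κ x 2) * MvPolynomial.X 1
  let M : ℙ ℂ (ternaryForms 1) → MvPolynomial (Fin 3) ℂ := fun x =>
    MvPolynomial.C (κ x 1) + MvPolynomial.C (κ x 2) * MvPolynomial.X 2
  have hN : ∀ x, N x ≠ 0 := by
    intro x h
    have e := fun t => congrArg (MvPolynomial.eval t) h
    have e0 := e ![0, 0, 0]
    have e1 := e ![1, 0, 0]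
    have e2 := e ![0, 1, 0]
    simp [N] at e0 e1 e2
    refine hκ0 x (funext fun i => ?_)
    fin_cases i <;> simp_all
  have hM : ∀ x y, x ≠ y → M x * N y - M y * N x ≠ 0 := by
    intro x y hxy h
    have e := fun t => congrArg (MvPolynomial.eval t) h
    have e0 := e ![0, 0, 0]
    have e1 := e ![0, 1, 0]
    have e2 := e ![0, 0, 1]
    simp [N, M] at e0 e1 e2
    have h10 : κ x 1 * κ y 0 = κ y 1 * κ x 0 := by linear_combination e0
    have h12 : κ x 1 * κ y 2 = κ y 1 * κ x 2 := by linear_combination e1 - e0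
    have h20 : κ x 2 * κ y 0 = κ y 2 * κ x 0 := by linear_combination e2 - e0
    have hminor := minors_eq h10 h12 h20
    refine hxy (projectivization_eq_of_dual fun l k => ?_)
    simp only [dual_eq_sum _ (Projectivization.rep _), Finset.sum_mul_sum]
    refine Finset.sum_congr rfl fun i _ => Finset.sum_congr rfl fun j _ => ?_
    rw [mul_mul_mul_comm, mul_mul_mul_comm (linForm.symm y.rep i)]
    exact congrArg (· * _) (hminor i j)
  have hprod : (∏ x ∈ s, N x) * ∏ z ∈ s.offDiag, (M z.1 * N z.2 - M z.2 * N z.1) ≠ 0 := by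
    refine mul_ne_zero (Finset.prod_ne_zero_iff.2 fun x _ => hN x)
      (Finset.prod_ne_zero_iff.2 fun z hz => hM _ _ (Finset.mem_offDiag.1 hz).2.2)
  obtain ⟨t, ht⟩ : ∃ t, MvPolynomial.eval t
      ((∏ x ∈ s, N x) * ∏ z ∈ s.offDiag, (M z.1 * N z.2 - M z.2 * N z.1)) ≠ 0 := by
    by_contra! h
    exact hprod (MvPolynomial.funext fun t => by rw [h t, map_zero])
  rw [map_mul, map_prod, map_prod] at ht
  have h1 := Finset.prod_ne_zero_iff.1 (left_ne_zero_of_mul ht)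
  have h2 := Finset.prod_ne_zero_iff.1 (right_ne_zero_of_mul ht)
  have hev : ∀ (l : ternaryForms 1) p, MvPolynomial.eval p (l : MvPolynomial (Fin 3) ℂ) =
      ∑ i, linForm.symm l i * p i := fun l p => by
    rw [← eval_linForm, LinearEquiv.apply_symm_apply]
  refine ⟨![1, t 0, t 1], ![0, 1, t 2], ![0, 0, 1],
    linForm.symm.trans (shear (t 0) (t 1) (t 2)), ⟨fun l => ?_, fun l => ?_, fun l => ?_⟩,
    fun x hx => ?_, fun x hx y hy hxy => ?_⟩
  · simp [hev, shear, Fin.sum_univ_three]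
  · simp [hev, shear, Fin.sum_univ_three]
  · simp [hev, shear, Fin.sum_univ_three]
  · simpa [N, κ, shear] using h1 x hx
  · have := h2 (x, y) (Finset.mem_offDiag.2 ⟨hx, hy, hxy⟩)
    rw [map_sub, sub_ne_zero] at this
    simpa [N, M, κ, shear] using this

/-! ### Charts of the space of ordered arrangements -/

noncomputable section OrderedCharts

variable {d : ℕ} (L : ternaryForms 1 ≃ₗ[ℂ] (Fin 3 → ℂ))

/-- Affine coordinates of `d` lines. -/
def lineCoords (x : Fin d → ℙ ℂ (ternaryForms 1)) : Fin d ⊕ Fin d → ℂ :=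
  Sum.elim (fun i => L (x i).rep 1 / L (x i).rep 0) fun i => L (x i).rep 2 / L (x i).rep 0

/-- The `d` linear forms with given affine coordinates. -/
def affineForms (t : Fin d ⊕ Fin d → ℂ) (i : Fin d) : ternaryForms 1 :=
  L.symm ![1, t (Sum.inl i), t (Sum.inr i)]

theorem affineForms_ne_zero (t : Fin d ⊕ Fin d → ℂ) (i : Fin d) : affineForms L t i ≠ 0 := by
  intro h
  rw [affineForms, LinearEquiv.map_eq_zero_iff] at h
  simpa using congrFun h 0

/-- The `d` lines with given affine coordinates. -/
def affineLines (t : Fin d ⊕ Fin d → ℂ) (i : Fin d) : ℙ ℂ (ternaryForms 1) :=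
  Projectivization.mk ℂ (affineForms L t i) (affineForms_ne_zero L t i)

theorem exists_affineLines_rep (t : Fin d ⊕ Fin d → ℂ) : ∃ c : Fin d → ℂ, (∀ i, c i ≠ 0) ∧
    ∀ i, (affineLines L t i).rep = c i • affineForms L t i := by
  choose c hc using fun i => exists_rep_mk_eq_smul (affineForms L t i) (affineForms_ne_zero L t i)
  exact ⟨c, fun i => (hc i).1, fun i => (hc i).2⟩

theorem affineLines_rep_zero_ne (t : Fin d ⊕ Fin d → ℂ) (i : Fin d) :
    L (affineLines L t i).rep 0 ≠ 0 := by
  obtain ⟨c, hc0, hc⟩ := exists_affineLines_rep L t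
  simp [hc, affineForms, hc0]

theorem lineCoords_affineLines (t : Fin d ⊕ Fin d → ℂ) : lineCoords L (affineLines L t) = t := by
  obtain ⟨c, hc0, hc⟩ := exists_affineLines_rep L t
  ext (i | i) <;> simp [lineCoords, hc, affineForms, hc0]

theorem affineLines_lineCoords {x : Fin d → ℙ ℂ (ternaryForms 1)}
    (hx : ∀ i, L (x i).rep 0 ≠ 0) : affineLines L (lineCoords L x) = x := by
  ext1 i
  rw [affineLines, ← (x i).mk_rep, Projectivization.mk_eq_mk_iff']
  refine ⟨(L (x i).rep 0)⁻¹, L.injective ?_⟩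
  have := hx i
  rw [map_smul, affineForms, LinearEquiv.apply_symm_apply]
  ext k
  fin_cases k <;> simp [lineCoords, this] <;> field_simp

/-- The polynomial testing whether the first affine coordinates are distinct. -/
def coordDiscr (d : ℕ) : MvPolynomial (Fin d ⊕ Fin d) ℂ :=
  ∏ z ∈ (Finset.univ : Finset (Fin d)).offDiag,
    (MvPolynomial.X (Sum.inl z.1) - MvPolynomial.X (Sum.inl z.2))

theorem eval_coordDiscr_ne_zero {t : Fin d ⊕ Fin d → ℂ} :
    MvPolynomial.eval t (coordDiscr d) ≠ 0 ↔ Function.Injective (t ∘ Sum.inl) := by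
  simp only [coordDiscr, map_prod, Finset.prod_ne_zero_iff, map_sub, MvPolynomial.eval_X,
    Finset.mem_offDiag, Finset.mem_univ, true_and, sub_ne_zero, Prod.forall]
  exact ⟨fun h i j hij => by_contra fun hne => h i j hne hij, fun h i j hne hij => hne (h hij)⟩

theorem exists_eval_affineForms (l : Module.Dual ℂ (Fin d → ternaryForms 1)) :
    ∃ P : MvPolynomial (Fin d ⊕ Fin d) ℂ, ∀ t, l (affineForms L t) = MvPolynomial.eval t P := by
  classical
  refine ⟨∑ i, ∑ k : Fin 3, (![1, MvPolynomial.X (Sum.inl i), MvPolynomial.X (Sum.inr i)] :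
    Fin 3 → MvPolynomial (Fin d ⊕ Fin d) ℂ) k *
      MvPolynomial.C (l (Pi.single i (L.symm (Pi.single k 1)))), fun t => ?_⟩
  have h1 : affineForms L t = ∑ i, Pi.single i (affineForms L t i) :=
    (Finset.univ_sum_single _).symm
  have h2 : ∀ i, affineForms L t i = ∑ k : Fin 3,
      (![1, t (Sum.inl i), t (Sum.inr i)] : Fin 3 → ℂ) k • L.symm (Pi.single k 1) := by
    intro i
    rw [affineForms]
    conv_lhs => rw [pi_eq_sum_univ' (![1, t (Sum.inl i), t (Sum.inr i)] : Fin 3 → ℂ)]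
    simp only [map_sum, map_smul]
  have h3 : ∀ i, Pi.single i (affineForms L t i) = ∑ k : Fin 3,
      (![1, t (Sum.inl i), t (Sum.inr i)] : Fin 3 → ℂ) k •
        (Pi.single i (L.symm (Pi.single k 1)) : Fin d → ternaryForms 1) := by
    intro i
    rw [h2]
    have := map_sum (LinearMap.single ℂ (fun _ : Fin d => ternaryForms 1) i)
      (fun k : Fin 3 => (![1, t (Sum.inl i), t (Sum.inr i)] : Fin 3 → ℂ) k •
        L.symm (Pi.single k 1)) Finset.univ
    simpa only [map_smul, LinearMap.single_apply] using this
  rw [h1]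
  simp only [h3, map_sum, map_smul, map_mul, MvPolynomial.eval_C, smul_eq_mul]
  refine Finset.sum_congr rfl fun i _ => Finset.sum_congr rfl fun k _ => ?_
  congr 1
  fin_cases k <;> simp

theorem rationalChart_ordered :
    RationalChart (multiprojForms fun _ : Fin d => ternaryForms 1) (orderedArrangementSpace d)
      {x | ∀ i, L (x i).rep 0 ≠ 0} (lineCoords L) (coordDiscr d) (affineLines L) where
  isOpen := by
    classical
    rw [Set.ofPred_forall]
    let _ := zariskiTopology (multiprojForms fun _ : Fin d => ternaryForms 1)
    exact isOpen_iInter_of_finite fun i => isOpen_ne_zero_of_mem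
      (dual_mem_multiprojForms i (LinearMap.proj 0 ∘ₗ L.toLinearMap))
  regular := by
    classical
    rintro (i | i)
    · exact ⟨_, _, dual_mem_multiprojForms i (LinearMap.proj 1 ∘ₗ L.toLinearMap), _,
        dual_mem_multiprojForms i (LinearMap.proj 0 ∘ₗ L.toLinearMap), fun x hx => ⟨hx i, rfl⟩⟩
    · exact ⟨_, _, dual_mem_multiprojForms i (LinearMap.proj 2 ∘ₗ L.toLinearMap), _,
        dual_mem_multiprojForms i (LinearMap.proj 0 ∘ₗ L.toLinearMap), fun x hx => ⟨hx i, rfl⟩⟩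
  mapsTo t ht := by
    refine ⟨fun i j hij => eval_coordDiscr_ne_zero.1 ht ?_, affineLines_rep_zero_ne L t⟩
    have h : ∀ i, (t ∘ Sum.inl) i =
        L (affineLines L t i).rep 1 / L (affineLines L t i).rep 0 := fun i =>
      (congrFun (lineCoords_affineLines L t) (Sum.inl i)).symm
    rw [h, h, hij]
  right_inv t _ := lineCoords_affineLines L t
  left_inv x hx _ := affineLines_lineCoords L hx.2
  pullback m := by
    choose c hc0 hc using fun t => exists_affineLines_rep (d := d) L t
    refine ⟨fun t => ∏ i, c t i ^ m i,
      fun t _ => Finset.prod_ne_zero_iff.2 fun i _ => pow_ne_zero _ (hc0 t i), ?_⟩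
    rintro _ ⟨F, ⟨hF, hF'⟩, rfl⟩
    obtain ⟨P, hP⟩ := exists_eval_eq_of_mem_polyFunctions (T := Set.univ)
      (fun l => (exists_eval_affineForms L l).imp fun _ h t _ => h t) hF
    refine ⟨P, fun t _ => ?_⟩
    rw [← hP t trivial, ← hF']
    simp only [LinearMap.funLeft_apply, hc]

theorem isSmoothIrreducibleVariety_ordered (d : ℕ) :
    IsSmoothIrreducibleVariety (multiprojForms fun _ : Fin d => ternaryForms 1)
      (orderedArrangementSpace d) (2 * d) := by
  classical
  have h := isSmoothIrreducibleVariety_of_charts (σ := Fin d ⊕ Fin d)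
    (multiprojForms fun _ : Fin d => ternaryForms 1) (orderedArrangementSpace d) ?_
    (fun x y => multiprojForms_separate) ?_
  · simpa [two_mul] using h
  · have hinj : Function.Injective (fun i : Fin d => ((i : ℕ) : ℂ)) := fun i j h =>
      Fin.ext (Nat.cast_injective h)
    exact ⟨_, ((rationalChart_ordered linForm.symm).mapsTo
      (Sum.elim (fun i : Fin d => ((i : ℕ) : ℂ)) 0) (eval_coordDiscr_ne_zero.2 hinj)).1⟩
  · intro x hx y hy
    obtain ⟨w, u, v, L, -, h0, h1⟩ := exists_frame (Finset.univ.image x ∪ Finset.univ.image y)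
    have key : ∀ z : Fin d → ℙ ℂ (ternaryForms 1), z ∈ orderedArrangementSpace d →
        (∀ i, z i ∈ Finset.univ.image x ∪ Finset.univ.image y) →
        z ∈ {x : Fin d → ℙ ℂ (ternaryForms 1) | ∀ i, L (x i).rep 0 ≠ 0} ∧
          MvPolynomial.eval (lineCoords L z) (coordDiscr d) ≠ 0 := by
      intro z hz hmem
      refine ⟨fun i => h0 _ (hmem i), eval_coordDiscr_ne_zero.2 fun i j hij => ?_⟩
      by_contra hne
      refine h1 _ (hmem i) _ (hmem j) (fun h => hne (hz h)) ?_
      have hij' : L (z i).rep 1 / L (z i).rep 0 = L (z j).rep 1 / L (z j).rep 0 := hij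
      rwa [div_eq_div_iff (h0 _ (hmem i)) (h0 _ (hmem j))] at hij'
    exact ⟨_, _, _, _, rationalChart_ordered L, key x hx fun i => by simp,
      key y hy fun i => by simp⟩

end OrderedCharts

/-! ### One-variable polynomials with given coefficients -/

section CoefficientPolynomials

open Polynomial

variable {R S : Type*} [CommRing R] [CommRing S] {d : ℕ}

/-- The polynomial of degree less than `d` with given coefficients. -/
noncomputable def lowPoly (c : Fin d → R) : R[X] := ∑ k : Fin d, C (c k) * X ^ (k : ℕ)

theorem degree_lowPoly_lt (c : Fin d → R) : (lowPoly c).degree < d := degree_sum_fin_lt c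

theorem coeff_lowPoly (c : Fin d → R) (k : Fin d) : (lowPoly c).coeff k = c k := by
  simp [lowPoly, finsetSum_coeff, coeff_C_mul, coeff_X_pow, Fin.val_inj]

theorem lowPoly_map (f : R →+* S) (c : Fin d → R) :
    (lowPoly c).map f = lowPoly fun k => f (c k) := by
  simp [lowPoly, Polynomial.map_sum]

theorem lowPoly_coeff {p : R[X]} (hp : p.degree < d) :
    lowPoly (fun k : Fin d => p.coeff k) = p := by
  ext n
  by_cases hn : n < d
  · exact coeff_lowPoly _ ⟨n, hn⟩
  · have hn' : (d : WithBot ℕ) ≤ n := by exact_mod_cast not_lt.1 hn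
    rw [coeff_eq_zero_of_degree_lt ((degree_lowPoly_lt _).trans_le hn'),
      coeff_eq_zero_of_degree_lt (hp.trans_le hn')]

/-- The monic polynomial of degree `d` with given lower coefficients. -/
noncomputable def monicPoly (c : Fin d → R) : R[X] := X ^ d + lowPoly c

theorem monic_monicPoly (c : Fin d → R) : (monicPoly c).Monic :=
  monic_X_pow_add (degree_lowPoly_lt c)

theorem natDegree_monicPoly [Nontrivial R] (c : Fin d → R) : (monicPoly c).natDegree = d := by
  rw [monicPoly, natDegree_add_eq_left_of_degree_lt, natDegree_X_pow]
  rw [degree_X_pow]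
  exact degree_lowPoly_lt c

theorem coeff_monicPoly (c : Fin d → R) (k : Fin d) : (monicPoly c).coeff k = c k := by
  simp [monicPoly, coeff_lowPoly, coeff_X_pow, k.2.ne]

theorem monicPoly_map (f : R →+* S) (c : Fin d → R) :
    (monicPoly c).map f = monicPoly fun k => f (c k) := by
  simp [monicPoly, lowPoly_map]

theorem monicPoly_coeff [Nontrivial R] {p : R[X]} (hp : p.Monic) (hd : p.natDegree = d) :
    monicPoly (fun k : Fin d => p.coeff k) = p := by
  have h : (p - X ^ d : R[X]).degree < (d : WithBot ℕ) := by
    have h1 : (X ^ d : R[X]).degree = p.degree := by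
      rw [degree_X_pow, degree_eq_natDegree hp.ne_zero, hd]
    have := degree_sub_lt_left h1.symm hp.ne_zero (by simp [hp.leadingCoeff])
    rwa [degree_eq_natDegree hp.ne_zero, hd] at this
  have h2 : (fun k : Fin d => p.coeff k) = fun k : Fin d => (p - X ^ d).coeff k := by
    ext k
    simp [coeff_X_pow, k.2.ne]
  rw [h2, monicPoly, lowPoly_coeff h]
  ring

/-- A monic polynomial over an algebraically closed field is the nodal polynomial of its roots. -/
theorem exists_nodal_eq_monicPoly {K : Type*} [Field K] [IsAlgClosed K] (c : Fin d → K) :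
    ∃ a : Fin d → K, monicPoly c = Lagrange.nodal Finset.univ a := by
  have hs := IsAlgClosed.splits (monicPoly c)
  have hcard : (monicPoly c).roots.toList.length = d := by
    rw [Multiset.length_toList, ← hs.natDegree_eq_card_roots, natDegree_monicPoly]
  refine ⟨fun i => (monicPoly c).roots.toList.get (i.cast hcard.symm), ?_⟩
  conv_lhs => rw [hs.eq_prod_roots_of_monic (monic_monicPoly c), ← Multiset.coe_toList (roots _)]
  rw [Lagrange.nodal, Multiset.map_coe, Multiset.prod_coe, ← List.prod_ofFn]
  congr 1
  refine List.ext_getElem (by simp [hcard]) fun i h1 h2 => by simp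

theorem resultant_nodal {a : Fin d → R} [IsDomain R] {g : R[X]} {n : ℕ} (hg : g.natDegree ≤ n) :
    resultant (Lagrange.nodal Finset.univ a) g d n = ∏ i, g.eval (a i) := by
  have h := resultant_prod_left Finset.univ (fun i => X - C (a i)) g n (by simp) hg
  have hd : (Lagrange.nodal Finset.univ a).natDegree = d := by
    rw [Lagrange.natDegree_nodal, Finset.card_univ, Fintype.card_fin]
  rw [← Lagrange.nodal_eq, hd] at h
  rw [h]
  exact Finset.prod_congr rfl fun i _ => by
    rw [natDegree_X_sub_C, resultant_X_sub_C_left _ _ _ hg]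

/-- The combination of the polynomials `∏ (X - a j)`, `j ≠ i`, with coefficients `b i`. -/
noncomputable def nodalCombination (a b : Fin d → R) : R[X] :=
  ∑ i, C (b i) * Lagrange.nodal (Finset.univ.erase i) a

theorem degree_nodalCombination_lt [Nontrivial R] (a b : Fin d → R) :
    (nodalCombination a b).degree < d := by
  refine (degree_sum_le _ _).trans_lt ((Finset.sup_lt_iff (WithBot.bot_lt_coe d)).2 fun i _ => ?_)
  refine (smul_eq_C_mul (b i) ▸ degree_smul_le _ _ : _ ≤ _).trans_lt ?_
  rw [Lagrange.degree_nodal, Finset.card_erase_of_mem (Finset.mem_univ i), Finset.card_univ,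
    Fintype.card_fin]
  exact WithBot.coe_lt_coe.2 (Nat.sub_lt (Fin.pos i) one_pos)

theorem eval_nodalCombination (a b : Fin d → R) (i : Fin d) :
    (nodalCombination a b).eval (a i) =
      b i * (derivative (Lagrange.nodal Finset.univ a)).eval (a i) := by
  rw [Lagrange.eval_nodal_derivative_eval_node_eq (Finset.mem_univ i), nodalCombination,
    eval_finsetSum, Finset.sum_eq_single i]
  · simp
  · intro j _ hj
    rw [eval_mul, Lagrange.eval_nodal_at_node (Finset.mem_erase.2 ⟨hj.symm, Finset.mem_univ i⟩),
      mul_zero]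
  · simp

theorem eval_derivative_nodal_ne_zero_iff [IsDomain R] {a : Fin d → R} :
    (∏ i, (derivative (Lagrange.nodal Finset.univ a)).eval (a i)) ≠ 0 ↔ Function.Injective a := by
  simp only [Finset.prod_ne_zero_iff, Finset.mem_univ, true_imp_iff,
    Lagrange.eval_nodal_derivative_eval_node_eq (Finset.mem_univ _), Lagrange.eval_nodal,
    Finset.mem_erase, and_true, sub_ne_zero]
  exact ⟨fun h i j hij => by_contra fun hne => h i j (fun e => hne e.symm) hij,
    fun h i j hne hij => hne (h hij.symm)⟩

end CoefficientPolynomials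

/-! ### Charts of the space of arrangements -/

noncomputable section ArrangementCharts

open Polynomial

theorem Derivation.map_finset_prod {R A M ι : Type*} [CommSemiring R] [CommSemiring A]
    [Algebra R A] [AddCommMonoid M] [Module A M] [Module R M] [DecidableEq ι]
    (D : Derivation R A M) (s : Finset ι) (f : ι → A) :
    D (∏ i ∈ s, f i) = ∑ i ∈ s, (∏ j ∈ s.erase i, f j) • D (f i) := by
  induction s using Finset.induction_on with
  | empty => simp
  | insert a s ha ih =>
    rw [Finset.prod_insert ha, D.leibniz, ih, Finset.sum_insert ha, Finset.erase_insert ha,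
      add_comm, Finset.smul_sum]
    congr 1
    refine Finset.sum_congr rfl fun i hi => ?_
    have hia : a ≠ i := fun h => ha (h ▸ hi)
    rw [Finset.erase_insert_of_ne hia, Finset.prod_insert (fun h => ha (Finset.mem_of_mem_erase h)),
      mul_smul]

/-- Restriction of a ternary polynomial to the line `T ↦ T w - u`. -/
def lineRestriction (w u : Fin 3 → ℂ) : MvPolynomial (Fin 3) ℂ →ₐ[ℂ] ℂ[X] :=
  MvPolynomial.aeval fun k => X * C (w k) - C (u k)

/-- Restriction of the derivative in the direction `v` to the line `T ↦ T w - u`. -/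
def lineDerivative (w u v : Fin 3 → ℂ) : MvPolynomial (Fin 3) ℂ →ₗ[ℂ] ℂ[X] :=
  (lineRestriction w u).toLinearMap ∘ₗ
    (MvPolynomial.mkDerivation ℂ fun k => MvPolynomial.C (v k) :
      Derivation ℂ (MvPolynomial (Fin 3) ℂ) (MvPolynomial (Fin 3) ℂ)).toLinearMap

variable {d : ℕ} {w u v : Fin 3 → ℂ} {L : ternaryForms 1 ≃ₗ[ℂ] (Fin 3 → ℂ)}

theorem IsFrame.lineRestriction (h : IsFrame w u v L) (l : ternaryForms 1) :
    lineRestriction w u (l : MvPolynomial (Fin 3) ℂ) = X * C (L l 0) - C (L l 1) := by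
  rw [← h.eval_zero, ← h.eval_one]
  obtain ⟨c, rfl⟩ := linForm.surjective l
  rw [eval_linForm, eval_linForm, coe_linForm]
  simp only [_root_.lineRestriction, map_sum, map_mul, MvPolynomial.aeval_C, MvPolynomial.aeval_X,
    Finset.mul_sum, ← Finset.sum_sub_distrib, algebraMap_eq]
  exact Finset.sum_congr rfl fun i _ => by ring

theorem IsFrame.mkDerivation (h : IsFrame w u v L) (l : ternaryForms 1) :
    (MvPolynomial.mkDerivation ℂ fun k => MvPolynomial.C (v k) :
      Derivation ℂ (MvPolynomial (Fin 3) ℂ) (MvPolynomial (Fin 3) ℂ))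
      (l : MvPolynomial (Fin 3) ℂ) = MvPolynomial.C (L l 2) := by
  rw [← h.eval_two]
  obtain ⟨c, rfl⟩ := linForm.surjective l
  rw [eval_linForm, coe_linForm]
  simp [MvPolynomial.mkDerivation_X]

theorem IsFrame.lineRestriction_prodForms (h : IsFrame w u v L) (s : Fin d ⊕ Fin d → ℂ) :
    _root_.lineRestriction w u (prodForms (affineForms L s) : MvPolynomial (Fin 3) ℂ) =
      Lagrange.nodal Finset.univ (s ∘ Sum.inl) := by
  simp only [prodForms, map_prod, h.lineRestriction, Lagrange.nodal, affineForms,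
    LinearEquiv.apply_symm_apply]
  simp

theorem IsFrame.lineDerivative_prodForms (h : IsFrame w u v L) (s : Fin d ⊕ Fin d → ℂ) :
    lineDerivative w u v (prodForms (affineForms L s) : MvPolynomial (Fin 3) ℂ) =
      nodalCombination (s ∘ Sum.inl) (s ∘ Sum.inr) := by
  simp only [lineDerivative, prodForms, LinearMap.comp_apply, Derivation.coeFn_coe,
    Derivation.map_finset_prod, h.mkDerivation, map_sum, nodalCombination, Lagrange.nodal]
  refine Finset.sum_congr rfl fun i _ => ?_
  simp only [smul_eq_mul, AlgHom.toLinearMap_apply, map_mul, map_prod, h.lineRestriction,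
    affineForms, LinearEquiv.apply_symm_apply]
  rw [mul_comm]
  congr 1
  · simp [_root_.lineRestriction]
  · simp

/-- Affine coordinates on the space of forms of degree `d`. -/
def formCoords (d : ℕ) (w u v : Fin 3 → ℂ) (x : ℙ ℂ (ternaryForms d)) : Fin d ⊕ Fin d → ℂ :=
  Sum.elim
    (fun k => (lineRestriction w u (x.rep : MvPolynomial (Fin 3) ℂ)).coeff k /
      (lineRestriction w u (x.rep : MvPolynomial (Fin 3) ℂ)).coeff d)
    (fun k => (lineDerivative w u v (x.rep : MvPolynomial (Fin 3) ℂ)).coeff k /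
      (lineRestriction w u (x.rep : MvPolynomial (Fin 3) ℂ)).coeff d)

theorem lineProduct_affineLines (L : ternaryForms 1 ≃ₗ[ℂ] (Fin 3 → ℂ)) (s : Fin d ⊕ Fin d → ℂ) :
    lineProduct d (affineLines L s) = Projectivization.mk ℂ (prodForms (affineForms L s))
      (prodForms_ne_zero (affineForms_ne_zero L s)) :=
  lineProduct_mk _ _

theorem coeff_nodal_univ (a : Fin d → ℂ) : (Lagrange.nodal Finset.univ a).coeff d = 1 := by
  have h := (Lagrange.nodal_monic (s := Finset.univ) (v := a)).coeff_natDegree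
  rwa [Lagrange.natDegree_nodal, Finset.card_univ, Fintype.card_fin] at h

theorem IsFrame.coeff_lineProduct_ne_zero (h : IsFrame w u v L) (s : Fin d ⊕ Fin d → ℂ) :
    (_root_.lineRestriction w u
      ((lineProduct d (affineLines L s)).rep : MvPolynomial (Fin 3) ℂ)).coeff d ≠ 0 := by
  rw [lineProduct_affineLines]
  obtain ⟨c, hc0, hc⟩ := exists_rep_mk_eq_smul _
    (prodForms_ne_zero (affineForms_ne_zero L s))
  rw [hc, Submodule.coe_smul, map_smul, h.lineRestriction_prodForms, coeff_smul,
    coeff_nodal_univ]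
  simpa using hc0

theorem IsFrame.formCoords_lineProduct (h : IsFrame w u v L) (s : Fin d ⊕ Fin d → ℂ) :
    formCoords d w u v (lineProduct d (affineLines L s)) =
      Sum.elim (fun k : Fin d => (Lagrange.nodal Finset.univ (s ∘ Sum.inl)).coeff k)
        (fun k : Fin d => (nodalCombination (s ∘ Sum.inl) (s ∘ Sum.inr)).coeff k) := by
  rw [lineProduct_affineLines]
  obtain ⟨c, hc0, hc⟩ := exists_rep_mk_eq_smul _
    (prodForms_ne_zero (affineForms_ne_zero L s))
  ext (k | k) <;>
  · simp only [formCoords, hc, Submodule.coe_smul, map_smul, h.lineRestriction_prodForms,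
      h.lineDerivative_prodForms, coeff_smul, coeff_nodal_univ, Sum.elim_inl, Sum.elim_inr]
    simp [hc0]

/-- The discriminant of the monic polynomial with given coefficients. -/
def coeffDiscr (d : ℕ) : MvPolynomial (Fin d ⊕ Fin d) ℂ :=
  resultant (monicPoly fun k : Fin d => (MvPolynomial.X (Sum.inl k) : MvPolynomial _ ℂ))
    (derivative (monicPoly fun k : Fin d => (MvPolynomial.X (Sum.inl k) : MvPolynomial _ ℂ))) d d

theorem eval_coeffDiscr {t : Fin d ⊕ Fin d → ℂ} {a : Fin d → ℂ}
    (ha : monicPoly (t ∘ Sum.inl) = Lagrange.nodal Finset.univ a) :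
    MvPolynomial.eval t (coeffDiscr d) =
      ∏ i, (derivative (Lagrange.nodal Finset.univ a)).eval (a i) := by
  have h : (monicPoly fun k : Fin d => (MvPolynomial.X (Sum.inl k) : MvPolynomial _ ℂ)).map
      (MvPolynomial.eval t) = Lagrange.nodal Finset.univ a := by
    rw [← ha, monicPoly_map]
    simp only [MvPolynomial.eval_X]
    rfl
  rw [coeffDiscr, ← resultant_map_map, ← derivative_map, h, resultant_nodal]
  · refine (natDegree_derivative_le _).trans ?_
    rw [Lagrange.natDegree_nodal, Finset.card_univ, Fintype.card_fin]
    omega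

/-- The roots of the monic polynomial with given coefficients. -/
def coeffRoots (t : Fin d ⊕ Fin d → ℂ) : Fin d → ℂ :=
  (exists_nodal_eq_monicPoly (t ∘ Sum.inl)).choose

theorem nodal_coeffRoots (t : Fin d ⊕ Fin d → ℂ) :
    monicPoly (t ∘ Sum.inl) = Lagrange.nodal Finset.univ (coeffRoots t) :=
  (exists_nodal_eq_monicPoly (t ∘ Sum.inl)).choose_spec

/-- The affine coordinates of the lines of an arrangement, in terms of the coordinates of the
arrangement. -/
def rootCoords (t : Fin d ⊕ Fin d → ℂ) : Fin d ⊕ Fin d → ℂ :=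
  Sum.elim (coeffRoots t) fun i => (lowPoly (t ∘ Sum.inr)).eval (coeffRoots t i) /
    (derivative (monicPoly (t ∘ Sum.inl))).eval (coeffRoots t i)

theorem eval_coeffDiscr_ne_zero {t : Fin d ⊕ Fin d → ℂ} :
    MvPolynomial.eval t (coeffDiscr d) ≠ 0 ↔ Function.Injective (coeffRoots t) := by
  rw [eval_coeffDiscr (nodal_coeffRoots t), eval_derivative_nodal_ne_zero_iff]

theorem derivative_eval_coeffRoots_ne_zero {t : Fin d ⊕ Fin d → ℂ}
    (ht : MvPolynomial.eval t (coeffDiscr d) ≠ 0) (i : Fin d) :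
    (derivative (monicPoly (t ∘ Sum.inl))).eval (coeffRoots t i) ≠ 0 := by
  rw [nodal_coeffRoots]
  rw [eval_coeffDiscr (nodal_coeffRoots t)] at ht
  exact Finset.prod_ne_zero_iff.1 ht i (Finset.mem_univ i)

theorem IsFrame.formCoords_lineProduct_rootCoords (h : IsFrame w u v L) {t : Fin d ⊕ Fin d → ℂ}
    (ht : MvPolynomial.eval t (coeffDiscr d) ≠ 0) :
    formCoords d w u v (lineProduct d (affineLines L (rootCoords t))) = t := by
  have h1 : Lagrange.nodal Finset.univ (rootCoords t ∘ Sum.inl) = monicPoly (t ∘ Sum.inl) :=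
    (nodal_coeffRoots t).symm
  have h2 : nodalCombination (rootCoords t ∘ Sum.inl) (rootCoords t ∘ Sum.inr) =
      lowPoly (t ∘ Sum.inr) := by
    refine Polynomial.eq_of_degrees_lt_of_eval_index_eq Finset.univ (v := coeffRoots t)
      (eval_coeffDiscr_ne_zero.1 ht).injOn ?_ ?_ fun i _ => ?_
    · simpa using degree_nodalCombination_lt _ _
    · simpa using degree_lowPoly_lt _
    · refine (eval_nodalCombination (coeffRoots t) (rootCoords t ∘ Sum.inr) i).trans ?_
      rw [← nodal_coeffRoots]
      exact div_mul_cancel₀ _ (derivative_eval_coeffRoots_ne_zero ht i)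
  rw [h.formCoords_lineProduct, h1, h2]
  ext (k | k)
  · exact coeff_monicPoly _ k
  · exact coeff_lowPoly _ k

end ArrangementCharts

/-! ### The space of arrangements is a smooth variety -/

noncomputable section ArrangementVariety

open Polynomial

variable {d : ℕ} {w u v : Fin 3 → ℂ} {L : ternaryForms 1 ≃ₗ[ℂ] (Fin 3 → ℂ)}

/-- The family of linear forms whose value at a root `a` of `P` is `P'(a)` times the form with
affine coordinates `a` and `Q(a) / P'(a)`. -/
def formFamily (L : ternaryForms 1 ≃ₗ[ℂ] (Fin 3 → ℂ)) {R : Type*} [CommRing R] [Algebra ℂ R]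
    (P Q : R[X]) : (MvPolynomial (Fin 3) R)[X] :=
  let m (k : Fin 3) : MvPolynomial (Fin 3) R := MvPolynomial.map (algebraMap ℂ R)
    (L.symm (Pi.single k 1) : MvPolynomial (Fin 3) ℂ)
  C (m 0) * (derivative P).map MvPolynomial.C + C (m 1) * (X * (derivative P).map MvPolynomial.C) +
    C (m 2) * Q.map MvPolynomial.C

theorem formFamily_map {R S : Type*} [CommRing R] [Algebra ℂ R] [CommRing S] [Algebra ℂ S]
    (f : R →ₐ[ℂ] S) (P Q : R[X]) : (formFamily L P Q).map (MvPolynomial.map (f : R →+* S)) =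
      formFamily L (P.map (f : R →+* S)) (Q.map (f : R →+* S)) := by
  have h : (f : R →+* S).comp (algebraMap ℂ R) = algebraMap ℂ S := f.comp_algebraMap
  have h' : (MvPolynomial.map (σ := Fin 3) (f : R →+* S)).comp MvPolynomial.C =
    MvPolynomial.C.comp (f : R →+* S) := MvPolynomial.map_comp_C _
  simp only [formFamily, Polynomial.map_add, Polynomial.map_mul, map_C, map_X, Polynomial.map_map,
    MvPolynomial.map_map, h, h', derivative_map]

theorem natDegree_formFamily_le {P Q : ℂ[X]} (hP : P.natDegree ≤ d) (hQ : Q.natDegree ≤ d) :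
    (formFamily L P Q).natDegree ≤ d + 1 := by
  have hP' := (natDegree_derivative_le P).trans (Nat.sub_le_of_le_add (hP.trans (Nat.le_succ d)))
  have h1 := (natDegree_map_le (f := MvPolynomial.C (σ := Fin 3)) (p := derivative P)).trans hP'
  have h2 := (natDegree_map_le (f := MvPolynomial.C (σ := Fin 3)) (p := Q)).trans hQ
  refine natDegree_add_le_of_degree_le (natDegree_add_le_of_degree_le ?_ ?_) ?_
  · exact (natDegree_C_mul_le _ _).trans (h1.trans d.le_succ)
  · exact (natDegree_C_mul_le _ _).trans
      ((natDegree_mul_le_of_le natDegree_X_le h1).trans (by omega))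
  · exact (natDegree_C_mul_le _ _).trans (h2.trans d.le_succ)

theorem eval_formFamily (s : Fin d ⊕ Fin d → ℂ) (P Q : ℂ[X]) (i : Fin d)
    (h : s (Sum.inr i) * (derivative P).eval (s (Sum.inl i)) = Q.eval (s (Sum.inl i))) :
    (formFamily L P Q).eval (MvPolynomial.C (s (Sum.inl i))) =
      MvPolynomial.C ((derivative P).eval (s (Sum.inl i))) *
        (affineForms L s i : MvPolynomial (Fin 3) ℂ) := by
  have h1 : (affineForms L s i : MvPolynomial (Fin 3) ℂ) =
      (L.symm (Pi.single 0 1) : MvPolynomial (Fin 3) ℂ) +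
        MvPolynomial.C (s (Sum.inl i)) * (L.symm (Pi.single 1 1) : MvPolynomial (Fin 3) ℂ) +
        MvPolynomial.C (s (Sum.inr i)) * (L.symm (Pi.single 2 1) : MvPolynomial (Fin 3) ℂ) := by
    unfold affineForms
    rw [pi_eq_sum_univ' (![1, s (Sum.inl i), s (Sum.inr i)] : Fin 3 → ℂ)]
    simp [Fin.sum_univ_three, MvPolynomial.smul_eq_C_mul]
  simp only [formFamily, eval_add, eval_mul, eval_C, eval_X, eval_map_apply, ← h, h1, map_mul]
  simp only [Algebra.algebraMap_self, MvPolynomial.map_id]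
  ring

/-- The product of the lines of an arrangement, up to a factor, as a polynomial in the coordinates
of the arrangement. -/
def universalForm (d : ℕ) (L : ternaryForms 1 ≃ₗ[ℂ] (Fin 3 → ℂ)) :
    MvPolynomial (Fin 3) (MvPolynomial (Fin d ⊕ Fin d) ℂ) :=
  resultant ((monicPoly fun k : Fin d => (MvPolynomial.X (Sum.inl k) :
      MvPolynomial (Fin d ⊕ Fin d) ℂ)).map MvPolynomial.C)
    (formFamily L (monicPoly fun k : Fin d => (MvPolynomial.X (Sum.inl k) : MvPolynomial _ ℂ))
      (lowPoly fun k : Fin d => (MvPolynomial.X (Sum.inr k) : MvPolynomial _ ℂ))) d (d + 1)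

theorem nodal_map {R S : Type*} [CommRing R] [CommRing S] (f : R →+* S) (a : Fin d → R) :
    (Lagrange.nodal Finset.univ a).map f = Lagrange.nodal Finset.univ fun i => f (a i) := by
  simp [Lagrange.nodal, Polynomial.map_prod]

theorem map_universalForm {s t : Fin d ⊕ Fin d → ℂ}
    (hP : monicPoly (t ∘ Sum.inl) = Lagrange.nodal Finset.univ (s ∘ Sum.inl))
    (hQ : ∀ i, s (Sum.inr i) * (derivative (monicPoly (t ∘ Sum.inl))).eval (s (Sum.inl i)) =
      (lowPoly (t ∘ Sum.inr)).eval (s (Sum.inl i))) :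
    MvPolynomial.map (MvPolynomial.eval t) (universalForm d L) =
      MvPolynomial.C (MvPolynomial.eval t (coeffDiscr d)) *
        (prodForms (affineForms L s) : MvPolynomial (Fin 3) ℂ) := by
  have h1 : (monicPoly fun k : Fin d =>
      (MvPolynomial.X (Sum.inl k) : MvPolynomial (Fin d ⊕ Fin d) ℂ)).map
      ((MvPolynomial.aeval t : MvPolynomial (Fin d ⊕ Fin d) ℂ →ₐ[ℂ] ℂ) :
        MvPolynomial (Fin d ⊕ Fin d) ℂ →+* ℂ) = monicPoly (t ∘ Sum.inl) := by
    rw [monicPoly_map]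
    simp [Function.comp_def]
  have h2 : (lowPoly fun k : Fin d =>
      (MvPolynomial.X (Sum.inr k) : MvPolynomial (Fin d ⊕ Fin d) ℂ)).map
      ((MvPolynomial.aeval t : MvPolynomial (Fin d ⊕ Fin d) ℂ →ₐ[ℂ] ℂ) :
        MvPolynomial (Fin d ⊕ Fin d) ℂ →+* ℂ) = lowPoly (t ∘ Sum.inr) := by
    rw [lowPoly_map]
    simp [Function.comp_def]
  have he : MvPolynomial.eval t =
      ((MvPolynomial.aeval t : _ →ₐ[ℂ] ℂ) : MvPolynomial (Fin d ⊕ Fin d) ℂ →+* ℂ) := by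
    ext <;> simp
  rw [eval_coeffDiscr hP, he, universalForm, ← resultant_map_map, formFamily_map,
    Polynomial.map_map, MvPolynomial.map_comp_C, ← Polynomial.map_map, h1, h2]
  conv_lhs => rw [hP, nodal_map]
  rw [resultant_nodal, map_prod, prodForms]
  · rw [← Finset.prod_mul_distrib]
    refine Finset.prod_congr rfl fun i _ => ?_
    rw [← hP]
    exact eval_formFamily s _ _ i (hQ i)
  · refine natDegree_formFamily_le ?_ ?_
    · rw [Lagrange.natDegree_nodal, Finset.card_univ, Fintype.card_fin]
    · exact natDegree_le_of_degree_le (degree_lowPoly_lt _).le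

theorem map_universalForm_rootCoords {t : Fin d ⊕ Fin d → ℂ}
    (ht : MvPolynomial.eval t (coeffDiscr d) ≠ 0) :
    MvPolynomial.map (MvPolynomial.eval t) (universalForm d L) =
      ((MvPolynomial.eval t (coeffDiscr d) • prodForms (affineForms L (rootCoords t)) :
        ternaryForms d) : MvPolynomial (Fin 3) ℂ) := by
  rw [map_universalForm (s := rootCoords t) (nodal_coeffRoots t), Submodule.coe_smul,
    MvPolynomial.smul_eq_C_mul]
  exact fun i => div_mul_cancel₀ _ (derivative_eval_coeffRoots_ne_zero ht i)

theorem exists_eval_universalForm (l : Module.Dual ℂ (ternaryForms d)) :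
    ∃ P : MvPolynomial (Fin d ⊕ Fin d) ℂ, ∀ t, MvPolynomial.eval t (coeffDiscr d) ≠ 0 →
      l (MvPolynomial.eval t (coeffDiscr d) • prodForms (affineForms L (rootCoords t))) =
        MvPolynomial.eval t P := by
  obtain ⟨l', hl'⟩ := LinearMap.exists_extend l
  refine ⟨∑ m ∈ (universalForm d L).support, (universalForm d L).coeff m *
    MvPolynomial.C (l' (MvPolynomial.monomial m 1)), fun t ht => ?_⟩
  rw [← hl', LinearMap.comp_apply, Submodule.subtype_apply, ← map_universalForm_rootCoords ht]
  conv_lhs => rw [(universalForm d L).as_sum]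
  simp only [map_sum, MvPolynomial.map_monomial, map_mul, MvPolynomial.eval_C]
  refine Finset.sum_congr rfl fun m _ => ?_
  rw [← mul_one (MvPolynomial.eval t _), ← smul_eq_mul, ← MvPolynomial.smul_monomial, map_smul,
    smul_eq_mul, smul_eq_mul, mul_one]

/-- The leading coefficient of the restriction to the line of a frame. -/
def leadingForm (d : ℕ) (w u : Fin 3 → ℂ) : Module.Dual ℂ (ternaryForms d) :=
  lcoeff ℂ d ∘ₗ (lineRestriction w u).toLinearMap ∘ₗ (ternaryForms d).subtype

theorem IsFrame.leadingForm_lineProduct_ne_zero (h : IsFrame w u v L)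
    {l : Fin d → ℙ ℂ (ternaryForms 1)} (hl : leadingForm d w u (lineProduct d l).rep ≠ 0)
    (i : Fin d) : L (l i).rep 0 ≠ 0 := by
  obtain ⟨c, -, hc⟩ := exists_rep_mk_eq_smul _ (prodForms_ne_zero fun i => (l i).rep_nonzero)
  have h1 : leadingForm d w u (prodForms fun i => (l i).rep) = ∏ i, L (l i).rep 0 := by
    have h2 := coeff_prod_of_natDegree_le (s := Finset.univ)
      (fun i => X * C (L (l i).rep 0) - C (L (l i).rep 1)) 1 fun i _ => by compute_degree
    simp only [Finset.card_univ, Fintype.card_fin, mul_one] at h2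
    simp only [leadingForm, prodForms, LinearMap.comp_apply, Submodule.subtype_apply,
      AlgHom.toLinearMap_apply, map_prod, h.lineRestriction, lcoeff_apply, h2]
    simp
  rw [lineProduct, hc, map_smul, h1, smul_eq_mul] at hl
  exact Finset.prod_ne_zero_iff.1 (right_ne_zero_of_mul hl) i (Finset.mem_univ i)

theorem IsFrame.formCoords_inl (h : IsFrame w u v L) (s : Fin d ⊕ Fin d → ℂ) :
    monicPoly (formCoords d w u v (lineProduct d (affineLines L s)) ∘ Sum.inl) =
      Lagrange.nodal Finset.univ (s ∘ Sum.inl) := by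
  rw [h.formCoords_lineProduct]
  refine monicPoly_coeff (p := Lagrange.nodal Finset.univ (s ∘ Sum.inl)) Lagrange.nodal_monic ?_
  rw [Lagrange.natDegree_nodal, Finset.card_univ, Fintype.card_fin]

theorem IsFrame.formCoords_inr (h : IsFrame w u v L) (s : Fin d ⊕ Fin d → ℂ) :
    lowPoly (formCoords d w u v (lineProduct d (affineLines L s)) ∘ Sum.inr) =
      nodalCombination (s ∘ Sum.inl) (s ∘ Sum.inr) := by
  rw [h.formCoords_lineProduct]
  exact lowPoly_coeff (degree_nodalCombination_lt _ _)

theorem IsFrame.eval_coeffDiscr_ne_zero (h : IsFrame w u v L) (s : Fin d ⊕ Fin d → ℂ) :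
    MvPolynomial.eval (formCoords d w u v (lineProduct d (affineLines L s))) (coeffDiscr d) ≠ 0 ↔
      Function.Injective (s ∘ Sum.inl) := by
  rw [eval_coeffDiscr (h.formCoords_inl s), eval_derivative_nodal_ne_zero_iff]

theorem IsFrame.rationalChart_arrangement (h : IsFrame w u v L) :
    RationalChart (projForms (ternaryForms d)) (arrangementSpace d)
      {x | leadingForm d w u x.rep ≠ 0} (formCoords d w u v) (coeffDiscr d)
      (fun t => lineProduct d (affineLines L (rootCoords t))) where
  isOpen := isOpen_ne_zero_of_mem (dual_mem_projForms (leadingForm d w u))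
  regular := by
    rintro (k | k)
    · exact ⟨_, _, dual_mem_projForms (lcoeff ℂ k ∘ₗ (_root_.lineRestriction w u).toLinearMap ∘ₗ
        (ternaryForms d).subtype), _, dual_mem_projForms (leadingForm d w u),
        fun x hx => ⟨hx, rfl⟩⟩
    · exact ⟨_, _, dual_mem_projForms (lcoeff ℂ k ∘ₗ lineDerivative w u v ∘ₗ
        (ternaryForms d).subtype), _, dual_mem_projForms (leadingForm d w u),
        fun x hx => ⟨hx, rfl⟩⟩
  mapsTo t ht := ⟨⟨_, ((rationalChart_ordered L).mapsTo (rootCoords t)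
    (eval_coordDiscr_ne_zero.2 (_root_.eval_coeffDiscr_ne_zero.1 ht))).1, rfl⟩,
    h.coeff_lineProduct_ne_zero _⟩
  right_inv t ht := h.formCoords_lineProduct_rootCoords ht
  left_inv := by
    rintro _ ⟨⟨l, -, rfl⟩, hU⟩ ht
    have hl := affineLines_lineCoords L fun i => h.leadingForm_lineProduct_ne_zero hU i
    generalize lineCoords L l = s at hl
    subst hl
    set t := formCoords d w u v (lineProduct d (affineLines L s)) with htdef
    have h1 := map_universalForm_rootCoords (L := L) ht
    rw [map_universalForm (h.formCoords_inl s), Submodule.coe_smul,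
      MvPolynomial.smul_eq_C_mul] at h1
    · have hC : MvPolynomial.C (σ := Fin 3) (MvPolynomial.eval t (coeffDiscr d)) ≠ 0 := by
        simpa using ht
      have h2 := Subtype.ext (mul_left_cancel₀ hC h1)
      simp only [lineProduct_affineLines, h2]
    · intro i
      rw [h.formCoords_inl, h.formCoords_inr]
      exact (eval_nodalCombination (s ∘ Sum.inl) (s ∘ Sum.inr) i).symm
  pullback m := by
    choose c hc0 hc using fun t => exists_rep_mk_eq_smul _
      (prodForms_ne_zero (affineForms_ne_zero L (rootCoords (d := d) t)))
    refine ⟨fun t => (c t / MvPolynomial.eval t (coeffDiscr d)) ^ m,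
      fun t ht => pow_ne_zero _ (div_ne_zero (hc0 t) ht), ?_⟩
    rintro _ ⟨F, ⟨hF, hF'⟩, rfl⟩
    obtain ⟨P, hP⟩ := exists_eval_eq_of_mem_polyFunctions
      (T := {t | MvPolynomial.eval t (coeffDiscr d) ≠ 0}) (exists_eval_universalForm (L := L)) hF
    refine ⟨P, fun t ht => ?_⟩
    rw [← hP t ht, ← hF', smul_smul, div_mul_cancel₀ _ ht]
    simp only [LinearMap.funLeft_apply, lineProduct_affineLines, hc]

theorem isSmoothIrreducibleVariety_arrangement (d : ℕ) :
    IsSmoothIrreducibleVariety (projForms (ternaryForms d)) (arrangementSpace d) (2 * d) := by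
  classical
  have h := isSmoothIrreducibleVariety_of_charts (σ := Fin d ⊕ Fin d)
    (projForms (ternaryForms d)) (arrangementSpace d) ?_ (fun x y => projForms_separate) ?_
  · simpa [two_mul] using h
  · obtain ⟨l, hl⟩ := (isSmoothIrreducibleVariety_ordered d).isIrreducible.1
    exact ⟨_, l, hl, rfl⟩
  · rintro _ ⟨x, hx, rfl⟩ _ ⟨y, hy, rfl⟩
    obtain ⟨w, u, v, L, h, h0, h1⟩ := exists_frame (Finset.univ.image x ∪ Finset.univ.image y)
    have key : ∀ z : Fin d → ℙ ℂ (ternaryForms 1), z ∈ orderedArrangementSpace d →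
        (∀ i, z i ∈ Finset.univ.image x ∪ Finset.univ.image y) →
        leadingForm d w u (lineProduct d z).rep ≠ 0 ∧
          MvPolynomial.eval (formCoords d w u v (lineProduct d z)) (coeffDiscr d) ≠ 0 := by
      intro z hz hmem
      rw [← affineLines_lineCoords L fun i => h0 _ (hmem i)]
      refine ⟨h.coeff_lineProduct_ne_zero _, (h.eval_coeffDiscr_ne_zero _).2 fun i j hij => ?_⟩
      by_contra hne
      refine h1 _ (hmem i) _ (hmem j) (fun h => hne (hz h)) ?_
      have hij' : L (z i).rep 1 / L (z i).rep 0 = L (z j).rep 1 / L (z j).rep 0 := hij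
      rwa [div_eq_div_iff (h0 _ (hmem i)) (h0 _ (hmem j))] at hij'
    exact ⟨_, _, _, _, h.rationalChart_arrangement, key x hx fun i => by simp,
      key y hy fun i => by simp⟩

end ArrangementVariety

/-! ### The classical topology of projective spaces -/

section ProjectiveTopology

variable {E F : Type*} [AddCommGroup E] [Module ℂ E] [AddCommGroup F] [Module ℂ F]

theorem isOpenQuotientMap_mk [TopologicalSpace E] [IsModuleTopology ℂ E] :
    IsOpenQuotientMap fun v : {v : E // v ≠ 0} => Projectivization.mk ℂ v.1 v.2 := by
  have hq : Topology.IsQuotientMap fun v : {v : E // v ≠ 0} => Projectivization.mk ℂ v.1 v.2 := by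
    refine ⟨⟨?_⟩, fun x => ⟨⟨x.rep, x.rep_nonzero⟩, x.mk_rep⟩⟩
    rw [instTopologicalSpaceSubtype, eq_moduleTopology ℂ E]
    rfl
  refine ⟨hq.surjective, hq.continuous, fun U hU => hq.isOpen_preimage.1 ?_⟩
  have h : (fun v : {v : E // v ≠ 0} => Projectivization.mk ℂ v.1 v.2) ⁻¹'
      ((fun v : {v : E // v ≠ 0} => Projectivization.mk ℂ v.1 v.2) '' U) =
      ⋃ a : ℂˣ, (fun v : {v : E // v ≠ 0} =>
        (⟨a • v.1, (smul_ne_zero_iff_ne a).2 v.2⟩ : {v : E // v ≠ 0})) ⁻¹' U := by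
    ext v
    simp only [Set.mem_preimage, Set.mem_image, Set.mem_iUnion, Projectivization.mk_eq_mk_iff]
    constructor
    · rintro ⟨x, hx, a, ha⟩
      refine ⟨a, ?_⟩
      convert hx
    · rintro ⟨a, ha⟩
      exact ⟨_, ha, a, rfl⟩
  rw [h]
  refine isOpen_iUnion fun a => hU.preimage (Continuous.subtype_mk ?_ _)
  exact (continuous_subtype_val.const_smul (a : ℂ))

instance projectivization_t2Space : T2Space (ℙ ℂ E) := by
  let _ : TopologicalSpace E := moduleTopology ℂ E
  have : ContinuousAdd E := ModuleTopology.continuousAdd ℂ E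
  rw [t2Space_iff_of_isOpenQuotientMap (isOpenQuotientMap_mk (E := E))]
  have h : {q : {v : E // v ≠ 0} × {v : E // v ≠ 0} |
      Projectivization.mk ℂ q.1.1 q.1.2 = Projectivization.mk ℂ q.2.1 q.2.2} =
      ⋂ (l : Module.Dual ℂ E) (k : Module.Dual ℂ E),
        {q | l q.1.1 * k q.2.1 = l q.2.1 * k q.1.1} := by
    ext q
    simp only [Set.mem_iInter, Set.mem_ofPred_eq]
    obtain ⟨c, hc0, hc⟩ := exists_rep_mk_eq_smul q.1.1 q.1.2
    obtain ⟨c', hc0', hc'⟩ := exists_rep_mk_eq_smul q.2.1 q.2.2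
    constructor
    · intro h l k
      rw [Projectivization.mk_eq_mk_iff'] at h
      obtain ⟨a, ha⟩ := h
      rw [← ha]
      simp only [map_smul, smul_eq_mul]
      ring
    · intro h
      refine projectivization_eq_of_dual fun l k => ?_
      rw [hc, hc']
      simp only [map_smul, smul_eq_mul]
      linear_combination c * c' * h l k
  rw [h]
  have hcont : ∀ l : Module.Dual ℂ E, Continuous l := fun l =>
    IsModuleTopology.continuous_of_linearMap l
  refine isClosed_iInter fun l => isClosed_iInter fun k => isClosed_eq ?_ ?_ <;>
  · have := hcont l
    have := hcont k
    fun_prop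

end ProjectiveTopology

/-! ### Lines and products of lines -/

noncomputable section LineTopology

/-- The line with given nonzero coefficients. -/
def linePoint (c : {c : Fin 3 → ℂ // c ≠ 0}) : ℙ ℂ (ternaryForms 1) :=
  Projectivization.mk ℂ (linForm c.1) (linForm.map_ne_zero_iff.2 c.2)

theorem linePoint_eq_iff {a b : {c : Fin 3 → ℂ // c ≠ 0}} :
    linePoint a = linePoint b ↔ ∃ c : ℂ, c • b.1 = a.1 := by
  rw [linePoint, linePoint, Projectivization.mk_eq_mk_iff']
  simp only [← map_smul, linForm.injective.eq_iff]

theorem isOpenQuotientMap_linePoint : IsOpenQuotientMap linePoint := by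
  let _ : TopologicalSpace (ternaryForms 1) := moduleTopology ℂ (ternaryForms 1)
  have : ContinuousAdd (ternaryForms 1) := ModuleTopology.continuousAdd ℂ _
  let e : (Fin 3 → ℂ) ≃ₜ ternaryForms 1 :=
    { linForm with
      continuous_toFun := IsModuleTopology.continuous_of_linearMap linForm.toLinearMap
      continuous_invFun := IsModuleTopology.continuous_of_linearMap linForm.symm.toLinearMap }
  let e' : {c : Fin 3 → ℂ // c ≠ 0} ≃ₜ {l : ternaryForms 1 // l ≠ 0} :=
    e.subtype fun c => linForm.map_ne_zero_iff.symm
  exact isOpenQuotientMap_mk.comp e'.isOpenQuotientMap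

instance compactSpace_lines : CompactSpace (ℙ ℂ (ternaryForms 1)) := by
  let f : Metric.sphere (0 : Fin 3 → ℂ) 1 → ℙ ℂ (ternaryForms 1) := fun c =>
    linePoint ⟨c.1, ne_zero_of_mem_unit_sphere c⟩
  have hf : Continuous f := isOpenQuotientMap_linePoint.continuous.comp
    (Continuous.subtype_mk continuous_subtype_val _)
  have hs : Function.Surjective f := by
    intro x
    obtain ⟨c, rfl⟩ := isOpenQuotientMap_linePoint.surjective x
    have h0 : ‖c.1‖ ≠ 0 := norm_ne_zero_iff.2 c.2
    have h0' : (‖c.1‖ : ℂ) ≠ 0 := Complex.ofReal_ne_zero.2 h0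
    refine ⟨⟨(‖c.1‖ : ℂ)⁻¹ • c.1, ?_⟩, linePoint_eq_iff.2 ⟨(‖c.1‖ : ℂ)⁻¹, rfl⟩⟩
    rw [mem_sphere_zero_iff_norm, norm_smul, norm_inv, Complex.norm_real, norm_norm,
      inv_mul_cancel₀ h0]
  exact isCompact_univ_iff.1 (hs.range_eq ▸ isCompact_range hf)

theorem prodForms_linForm {d : ℕ} (c : Fin d → Fin 3 → ℂ) :
    prodForms (fun i => linForm (c i)) = ∑ f : Fin d → Fin 3, (∏ i, c i (f i)) •
      prodForms fun i => linForm (Pi.single (f i) 1) := by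
  have h : ∀ k : Fin 3, (linForm (Pi.single k 1) : MvPolynomial (Fin 3) ℂ) = MvPolynomial.X k := by
    intro k
    simp [coe_linForm, Pi.single_apply]
  refine Subtype.ext ?_
  simp only [prodForms, h, Submodule.coe_sum, Submodule.coe_smul, MvPolynomial.smul_eq_C_mul,
    map_prod, ← Finset.prod_mul_distrib]
  simp only [coe_linForm, Finset.prod_univ_sum, Fintype.piFinset_univ]

theorem continuous_lineProduct (d : ℕ) : Continuous (lineProduct d) := by
  let _ : TopologicalSpace (ternaryForms d) := moduleTopology ℂ (ternaryForms d)
  have : ContinuousAdd (ternaryForms d) := ModuleTopology.continuousAdd ℂ _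
  have hq := IsOpenQuotientMap.piMap fun _ : Fin d => isOpenQuotientMap_linePoint
  rw [hq.isQuotientMap.continuous_iff]
  have h : lineProduct d ∘ Pi.map (fun _ : Fin d => linePoint) = fun c =>
      Projectivization.mk ℂ (prodForms fun i => linForm (c i).1)
        (prodForms_ne_zero fun i => linForm.map_ne_zero_iff.2 (c i).2) :=
    funext fun c => lineProduct_mk _ _
  rw [h]
  have h0 : ∀ c : Fin d → {c : Fin 3 → ℂ // c ≠ 0}, prodForms (fun i => linForm (c i).1) ≠ 0 :=
    fun c => prodForms_ne_zero fun i => linForm.map_ne_zero_iff.2 (c i).2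
  refine (isOpenQuotientMap_mk (E := ternaryForms d)).continuous.comp
    (Continuous.subtype_mk (f := fun c : Fin d → {c : Fin 3 → ℂ // c ≠ 0} =>
      prodForms fun i => linForm (c i).1) ?_ h0)
  have hc : (fun c : Fin d → {c : Fin 3 → ℂ // c ≠ 0} => prodForms fun i => linForm (c i).1) =
      fun c => ∑ f : Fin d → Fin 3, (∏ i, (c i).1 (f i)) •
        prodForms fun i => linForm (Pi.single (f i) 1) := funext fun c => prodForms_linForm _
  rw [hc]
  refine continuous_finsetSum _ fun f _ => Continuous.fun_smul ?_ continuous_const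
  exact continuous_finsetProd _ fun i _ =>
    (continuous_apply (f i)).comp (continuous_subtype_val.comp (continuous_apply i))

/-- The multiplication map from ordered arrangements to arrangements. -/
def arrangementMap (d : ℕ) (l : orderedArrangementSpace d) : arrangementSpace d :=
  ⟨lineProduct d l, l.1, l.2, rfl⟩

theorem isQuotientMap_arrangementMap (d : ℕ) : Topology.IsQuotientMap (arrangementMap d) := by
  have h1 : IsClosedMap (lineProduct d) := (continuous_lineProduct d).isClosedMap
  have h2 := h1.restrictPreimage (arrangementSpace d)
  have h3 : Continuous (arrangementMap d) :=
    Continuous.subtype_mk ((continuous_lineProduct d).comp continuous_subtype_val) _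
  have h4 : Function.Surjective (arrangementMap d) := by
    rintro ⟨_, l, hl, rfl⟩
    exact ⟨⟨l, hl⟩, rfl⟩
  refine IsClosedMap.isQuotientMap ?_ h3 h4
  let e := Homeomorph.setCongr (orderedArrangementSpace_eq_preimage d)
  have h5 : arrangementMap d = (arrangementSpace d).restrictPreimage (lineProduct d) ∘ e := rfl
  exact h5 ▸ h2.comp e.isClosedMap

/-- Permutations of the lines of an ordered arrangement. -/
instance orderedArrangementSpace_mulAction (d : ℕ) :
    MulAction (Equiv.Perm (Fin d)) (orderedArrangementSpace d) where
  smul σ l := ⟨l.1 ∘ σ.symm, l.2.comp σ.symm.injective⟩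
  one_smul _ := rfl
  mul_smul _ _ _ := rfl

theorem exists_perm_of_lineProduct_eq {d : ℕ} {l m : Fin d → ℙ ℂ (ternaryForms 1)}
    (hl : Function.Injective l) (h : lineProduct d l = lineProduct d m) :
    ∃ σ : Equiv.Perm (Fin d), m ∘ σ = l := by
  rw [lineProduct, lineProduct, Projectivization.mk_eq_mk_iff'] at h
  obtain ⟨a, ha⟩ := h
  have ha' : a • ∏ i, ((m i).rep : MvPolynomial (Fin 3) ℂ) =
      ∏ i, ((l i).rep : MvPolynomial (Fin 3) ℂ) := congrArg Subtype.val ha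
  have ha0 : a ≠ 0 := by
    rintro rfl
    rw [zero_smul] at ha'
    obtain ⟨i, -, hi⟩ := Finset.prod_eq_zero_iff.1 ha'.symm
    exact (irreducible_rep (l i)).ne_zero hi
  have key : ∀ i, ∃ j, m j = l i := by
    intro i
    have h1 : ((l i).rep : MvPolynomial (Fin 3) ℂ) ∣ ∏ i, ((m i).rep : MvPolynomial (Fin 3) ℂ) := by
      have : ∏ i, ((m i).rep : MvPolynomial (Fin 3) ℂ) =
          a⁻¹ • ∏ i, ((l i).rep : MvPolynomial (Fin 3) ℂ) := by
        rw [← ha', inv_smul_smul₀ ha0]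
      rw [this, MvPolynomial.smul_eq_C_mul]
      exact (Finset.dvd_prod_of_mem _ (Finset.mem_univ i)).mul_left _
    obtain ⟨j, -, hj⟩ := ((irreducible_rep (l i)).prime.dvd_finsetProd_iff _).1 h1
    exact ⟨j, (eq_of_rep_dvd hj).symm⟩
  choose σ hσ using key
  have hσ' : Function.Injective σ := fun i j hij => hl (by rw [← hσ, ← hσ, hij])
  exact ⟨Equiv.ofBijective σ (Finite.injective_iff_bijective.1 hσ'), funext hσ⟩

theorem lineProduct_comp_perm {d : ℕ} (l : Fin d → ℙ ℂ (ternaryForms 1))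
    (σ : Equiv.Perm (Fin d)) : lineProduct d (l ∘ σ) = lineProduct d l := by
  simp only [lineProduct, prodForms, Function.comp_apply,
    Equiv.prod_comp σ fun i => ((l i).rep : MvPolynomial (Fin 3) ℂ)]

theorem isQuotientCoveringMap_arrangementMap (d : ℕ) :
    IsQuotientCoveringMap (arrangementMap d) (Equiv.Perm (Fin d)) where
  __ := isQuotientMap_arrangementMap d
  continuous_const_smul σ := by
    refine Continuous.subtype_mk (f := fun l : orderedArrangementSpace d => l.1 ∘ σ.symm) ?_ _
    exact continuous_pi fun i => (continuous_apply _).comp continuous_subtype_val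
  apply_eq_iff_mem_orbit {l m} := by
    constructor
    · intro h
      obtain ⟨σ, hσ⟩ := exists_perm_of_lineProduct_eq l.2 (congrArg Subtype.val h)
      exact ⟨σ⁻¹, Subtype.ext hσ⟩
    · rintro ⟨σ, rfl⟩
      exact Subtype.ext (lineProduct_comp_perm m.1 σ.symm)
  disjoint l := by
    obtain ⟨U, hU, hdisj⟩ := (Set.finite_range l.1).t2_separation
    refine ⟨{m | ∀ i, m.1 i ∈ U (l.1 i)}, ?_, ?_⟩
    · rw [Set.ofPred_forall]
      refine (isOpen_iInter_of_finite fun i => ?_).mem_nhds (Set.mem_iInter.2 fun i => (hU _).1)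
      exact (hU _).2.preimage ((continuous_apply i).comp continuous_subtype_val)
    · rintro σ ⟨_, ⟨m, hm, rfl⟩, hm'⟩
      refine Equiv.ext fun i => ?_
      by_contra hne
      have h1 : m.1 i ∈ U (l.1 (σ i)) := by
        have h2 : m.1 (σ.symm (σ i)) ∈ U (l.1 (σ i)) := hm' (σ i)
        rwa [σ.symm_apply_apply] at h2
      exact Set.disjoint_left.1 (hdisj ⟨_, rfl⟩ ⟨_, rfl⟩ fun h => hne (l.2 h)) h1 (hm i)

theorem nonempty_fundamentalGroup_mulEquiv (d : ℕ)
    [SimplyConnectedSpace (orderedArrangementSpace d)] (f : arrangementSpace d) :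
    Nonempty (FundamentalGroup (arrangementSpace d) f ≃* Equiv.Perm (Fin d)) := by
  obtain ⟨l, hl⟩ := (isQuotientMap_arrangementMap d).surjective f
  exact ⟨((isQuotientCoveringMap_arrangementMap d).fundamentalGroupEquiv ⟨l, hl⟩).trans
    (MulEquiv.inv' _).symm⟩

end LineTopology

/-! ### Criteria for simple connectedness -/

section SimplyConnected

open unitInterval

variable {X Y : Type*} [TopologicalSpace X] [TopologicalSpace Y]

theorem Path.Homotopic.of_eq {x y x' y' : X} {p q : Path x y} {p' q' : Path x' y'}
    (h : p.Homotopic q) (hp : ∀ t, p t = p' t) (hq : ∀ t, q t = q' t) : p'.Homotopic q' := by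
  obtain rfl : x = x' := by rw [← p.source, hp, p'.source]
  obtain rfl : y = y' := by rw [← p.target, hp, p'.target]
  obtain rfl : p = p' := Path.ext (funext hp)
  obtain rfl : q = q' := Path.ext (funext hq)
  exact h

/-- A freely null-homotopic loop is null-homotopic. -/
theorem Path.homotopic_refl_of_free {x z : X} (p : Path x x) (H : C(I × I, X))
    (hp : ∀ t, H (t, 0) = p t) (hz : ∀ t, H (t, 1) = z) (hs : ∀ r, H (0, r) = H (1, r)) :
    p.Homotopic (Path.refl x) := by
  let b : Path ((0, 0) : I × I) (1, 0) :=
    ⟨⟨fun t => (t, 0), by fun_prop⟩, rfl, rfl⟩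
  let l : Path ((0, 0) : I × I) (0, 1) :=
    ⟨⟨fun t => (0, t), by fun_prop⟩, rfl, rfl⟩
  let r : Path ((1, 0) : I × I) (1, 1) :=
    ⟨⟨fun t => (1, t), by fun_prop⟩, rfl, rfl⟩
  let u : Path ((0, 1) : I × I) (1, 1) :=
    ⟨⟨fun t => (t, 1), by fun_prop⟩, rfl, rfl⟩
  let l' : Path x z := ⟨⟨fun t => H (0, t), by fun_prop⟩, by simp [hp], by simp [hz]⟩
  have : ContractibleSpace I := (convex_Icc (0 : ℝ) 1).contractibleSpace ⟨0, by simp⟩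
  have h1 := (SimplyConnectedSpace.paths_homotopic b ((l.trans u).trans r.symm)).map H
  have h2 : p.Homotopic ((l'.trans (Path.refl z)).trans l'.symm) := by
    refine h1.of_eq hp fun t => ?_
    simp only [Path.map_coe, Function.comp_apply, Path.trans_apply]
    split_ifs
    · rfl
    · exact hz _
    · exact (hs _).symm
  have h3 : (Path.refl x).Homotopic (l'.trans l'.symm) := ⟨Path.Homotopy.reflTransSymm l'⟩
  refine h2.trans (Path.Homotopic.trans ?_ h3.symm)
  exact Path.Homotopic.hcomp ⟨Path.Homotopy.transRefl l'⟩ (Path.Homotopic.refl _)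

/-- A path lifts along `π`, up to homotopy, from any starting point. -/
def HomotopyLifts (π : C(Y, X)) {a b : X} (γ : Path a b) : Prop :=
  ∀ (y : Y) (hy : π y = a), ∃ (y' : Y) (hy' : π y' = b) (δ : Path y y'),
    (δ.map π.continuous).Homotopic (γ.cast hy hy')

namespace HomotopyLifts

variable {π : C(Y, X)} {a b c : X}

theorem congr {γ γ' : Path a b} (h : HomotopyLifts π γ) (hγ : γ.Homotopic γ') :
    HomotopyLifts π γ' := by
  intro y hy
  obtain ⟨y', hy', δ, hδ⟩ := h y hy
  exact ⟨y', hy', δ, hδ.trans (hγ.of_eq (fun _ => rfl) fun _ => rfl)⟩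

theorem trans {γ : Path a b} {γ' : Path b c} (h : HomotopyLifts π γ) (h' : HomotopyLifts π γ') :
    HomotopyLifts π (γ.trans γ') := by
  intro y hy
  obtain ⟨y', hy', δ, hδ⟩ := h y hy
  obtain ⟨y'', hy'', δ', hδ'⟩ := h' y' hy'
  subst hy hy' hy''
  refine ⟨y'', rfl, δ.trans δ', ?_⟩
  rw [Path.map_trans]
  exact hδ.hcomp hδ'

theorem of_section (hfib : ∀ y y', π y = π y' → ∃ γ : Path y y', ∀ t, π (γ t) = π y)
    {U : Set X} {s : X → Y} (hs : ContinuousOn s U) (hπ : ∀ z ∈ U, π (s z) = z) (γ : Path a b)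
    (hγ : ∀ t, γ t ∈ U) : HomotopyLifts π γ := by
  intro y hy
  have ha : a ∈ U := by simpa using hγ 0
  have hb : b ∈ U := by simpa using hγ 1
  obtain ⟨δ, hδ⟩ := hfib y (s a) (by rw [hy, hπ a ha])
  let δ' : Path (s a) (s b) :=
    ⟨⟨s ∘ γ, hs.comp_continuous γ.continuous hγ⟩, by simp, by simp⟩
  refine ⟨s b, hπ b hb, δ.trans δ', ?_⟩
  have h : ((Path.refl a).trans γ).Homotopic γ := ⟨Path.Homotopy.reflTrans γ⟩
  refine h.of_eq (fun t => ?_) fun t => rfl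
  simp only [Path.map_coe, Function.comp_apply, Path.trans_apply]
  split_ifs
  · rw [hδ, hy]
    rfl
  · exact (hπ _ (hγ _)).symm

theorem of_local_sections (hfib : ∀ y y', π y = π y' → ∃ γ : Path y y', ∀ t, π (γ t) = π y)
    (hsec : ∀ x, ∃ U : Set X, IsOpen U ∧ x ∈ U ∧ ∃ s : X → Y, ContinuousOn s U ∧
      ∀ z ∈ U, π (s z) = z) (γ : Path a b) : HomotopyLifts π γ := by
  choose U hU hxU s hs hπ using hsec
  obtain ⟨t, ht0, htm, ⟨m, hm⟩, htU⟩ := exists_monotone_Icc_subset_open_cover_unitInterval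
    (c := fun x => γ ⁻¹' (U x)) (fun x => (hU x).preimage γ.continuous)
    fun t _ => Set.mem_iUnion.2 ⟨γ t, hxU _⟩
  have key : ∀ n, HomotopyLifts π (γ.subpath 0 (t n)) := by
    intro n
    induction n with
    | zero =>
      rw [ht0, Path.subpath_self]
      obtain ⟨x, hx⟩ := htU 0
      intro y hy
      exact ⟨y, hy, Path.refl y, (Path.Homotopic.refl (Path.refl (γ 0))).of_eq
        (fun _ => hy.symm) fun _ => rfl⟩
    | succ n ih =>
      obtain ⟨x, hx⟩ := htU n
      refine (ih.trans (of_section hfib (hs x) (hπ x) (γ.subpath (t n) (t (n + 1))) ?_)).congr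
        ⟨Path.Homotopy.subpathTransSubpath γ _ _ _⟩
      intro u
      have h1 : γ.subpath (t n) (t (n + 1)) u ∈ γ '' Set.Icc (t n) (t (n + 1)) := by
        rw [← Path.range_subpath_of_le _ _ _ (htm n.le_succ)]
        exact ⟨u, rfl⟩
      obtain ⟨v, hv, hv'⟩ := h1
      rw [← hv']
      exact hx hv
  have h1 := key m
  rw [hm m le_rfl] at h1
  intro y hy
  obtain ⟨y', hy', δ, hδ⟩ := h1 y (hy.trans γ.source.symm)
  refine ⟨y', hy'.trans γ.target, δ, hδ.of_eq (fun _ => rfl) fun t => ?_⟩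
  simp [Path.subpath_zero_one]

end HomotopyLifts

/-- The image of a simply connected space under a map with local sections and with path connected
fibres is simply connected. -/
theorem simplyConnectedSpace_of_local_sections [SimplyConnectedSpace Y] (π : C(Y, X))
    (hfib : ∀ y y', π y = π y' → ∃ γ : Path y y', ∀ t, π (γ t) = π y)
    (hsec : ∀ x, ∃ U : Set X, IsOpen U ∧ x ∈ U ∧ ∃ s : X → Y, ContinuousOn s U ∧
      ∀ z ∈ U, π (s z) = z) : SimplyConnectedSpace X := by
  have hsurj : Function.Surjective π := fun x => by
    obtain ⟨U, -, hx, s, -, hs⟩ := hsec x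
    exact ⟨s x, hs x hx⟩
  refine simply_connected_iff_loops_nullhomotopic.2
    ⟨hsurj.pathConnectedSpace π.continuous, fun x γ => ?_⟩
  obtain ⟨y, rfl⟩ := hsurj x
  obtain ⟨y', hy', δ, hδ⟩ := HomotopyLifts.of_local_sections hfib hsec γ y rfl
  obtain ⟨ε, hε⟩ := hfib y' y hy'
  have h1 : ((δ.trans ε).map π.continuous).Homotopic (Path.refl (π y)) :=
    ((SimplyConnectedSpace.paths_homotopic (δ.trans ε) (Path.refl y)).map π).of_eq
      (fun _ => rfl) fun _ => rfl
  have h2 : ((δ.trans ε).map π.continuous).Homotopic (γ.trans (Path.refl _)) := by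
    rw [Path.map_trans]
    refine (hδ.hcomp (Path.Homotopic.refl (ε.map π.continuous))).of_eq (fun _ => rfl) fun t => ?_
    simp only [Path.trans_apply]
    split_ifs
    · rfl
    · exact (hε _).trans hy'
  have h3 : (γ.trans (Path.refl _)).Homotopic γ := ⟨Path.Homotopy.transRefl γ⟩
  exact h3.symm.trans (h2.symm.trans h1)

end SimplyConnected

/-! ### Complements of subsets of real codimension at least three -/

section Codimension

open unitInterval Module

variable {E : Type*} [NormedAddCommGroup E] [NormedSpace ℝ E]

theorem Path.homotopic_of_segment_subset {Y : Set E} {x y : Y} (p q : Path x y)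
    (h : ∀ t, segment ℝ (p t : E) (q t) ⊆ Y) : p.Homotopic q := by
  have hmem : ∀ z : I × I, AffineMap.lineMap (p z.2 : E) (q z.2 : E) (z.1 : ℝ) ∈ Y := fun z =>
    h z.2 (segment_eq_image_lineMap ℝ (p z.2 : E) (q z.2) ▸ ⟨_, z.1.2, rfl⟩)
  refine ⟨{ toFun := fun z => ⟨_, hmem z⟩
            continuous_toFun := Continuous.subtype_mk ?_ _
            map_zero_left := fun t => Subtype.ext ?_
            map_one_left := fun t => Subtype.ext ?_
            prop' := ?_ }⟩
  · simp only [AffineMap.lineMap_apply_module]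
    fun_prop
  · simp
  · simp
  · rintro s t (rfl | rfl) <;> exact Subtype.ext (by simp)

theorem Path.homotopic_refl_of_cone {Y : Set E} {x : Y} (p : Path x x) (q : E)
    (h : ∀ t, segment ℝ (p t : E) q ⊆ Y) : p.Homotopic (Path.refl x) := by
  have hmem : ∀ z : I × I, AffineMap.lineMap (p z.1 : E) q (z.2 : ℝ) ∈ Y := fun z =>
    h z.1 (segment_eq_image_lineMap ℝ (p z.1 : E) q ▸ ⟨_, z.2.2, rfl⟩)
  refine p.homotopic_refl_of_free (z := ⟨q, h 0 (right_mem_segment ℝ _ _)⟩)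
    ⟨fun z => ⟨_, hmem z⟩, Continuous.subtype_mk ?_ _⟩ (fun t => Subtype.ext ?_)
    (fun t => Subtype.ext ?_) fun r => Subtype.ext ?_
  · simp only [AffineMap.lineMap_apply_module]
    fun_prop
  · simp
  · simp
  · simp

variable [FiniteDimensional ℝ E] {ι : Type*} {F : ι → Type*}
  [∀ k, NormedAddCommGroup (F k)] [∀ k, NormedSpace ℝ (F k)] [∀ k, FiniteDimensional ℝ (F k)]

/-- The cone over a smooth path from a generic point avoids a subset of codimension three. -/
theorem exists_cone_subset [Countable ι] {Y : Set E} {g : ∀ k, F k → E}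
    (hg : ∀ k, ContDiff ℝ 1 (g k)) (hE : 0 < finrank ℝ E)
    (hdim : ∀ k, finrank ℝ (F k) + 2 < finrank ℝ E) (hY : Yᶜ ⊆ ⋃ k, Set.range (g k)) {p : ℝ → E} (hp : ContDiff ℝ 1 p) :
    ∃ q, ∀ t, p t ∈ Y → segment ℝ (p t) q ⊆ Y := by
  let G : ∀ k, (F k × ℝ) × ℝ → E := fun k z => z.1.2 • g k z.1.1 - (z.1.2 - 1) • p z.2
  have hG : ∀ k, ContDiff ℝ 1 (G k) := fun k => by
    have := hg k
    fun_prop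
  have hd : dimH (⋃ k, Set.range (G k)) < finrank ℝ E := by
    rw [dimH_iUnion]
    refine (iSup_lt_iff).2 ⟨(finrank ℝ E - 1 : ℕ), ?_, fun k => (hG k).dimH_range_le.trans ?_⟩
    · exact_mod_cast Nat.sub_lt hE one_pos
    · have := hdim k
      rw [finrank_prod, finrank_prod, finrank_self]
      exact_mod_cast (by omega)
  obtain ⟨q, hq⟩ := (dense_compl_of_dimH_lt_finrank hd).nonempty
  refine ⟨q, fun t ht z hz => ?_⟩
  by_contra hzY
  obtain ⟨k, x, hx⟩ := Set.mem_iUnion.1 (hY hzY)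
  rw [segment_eq_image] at hz
  obtain ⟨r, -, hr⟩ := hz
  have hr0 : r ≠ 0 := by
    rintro rfl
    refine hzY ?_
    rw [← hr]
    simpa using ht
  refine hq (Set.mem_iUnion.2 ⟨k, ((x, r⁻¹), t), ?_⟩)
  have h2 : q = r⁻¹ • (g k x - (1 - r) • p t) := by
    rw [hx, ← hr]
    simp [smul_smul, hr0]
  simp only [G]
  rw [h2, smul_sub, smul_smul]
  congr 2
  field_simp

/-- The complement of a closed subset of codimension at least three is simply connected. -/
theorem simplyConnectedSpace_of_codimension [Countable ι] {Y : Set E} (hYo : IsOpen Y)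
    (hne : Y.Nonempty)
    {g : ∀ k, F k → E} (hg : ∀ k, ContDiff ℝ 1 (g k))
    (hE : 0 < finrank ℝ E) (hdim : ∀ k, finrank ℝ (F k) + 2 < finrank ℝ E)
    (hY : Yᶜ ⊆ ⋃ k, Set.range (g k)) : SimplyConnectedSpace Y := by
  have hcone := fun {p : ℝ → E} (hp : ContDiff ℝ 1 p) => exists_cone_subset hg hE hdim hY hp
  refine simply_connected_iff_loops_nullhomotopic.2 ⟨?_, fun y γ => ?_⟩
  · rw [← isPathConnected_iff_pathConnectedSpace]
    obtain ⟨x, hx⟩ := hne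
    refine ⟨x, hx, fun y hy => ?_⟩
    obtain ⟨q, hq⟩ := hcone (p := fun t => AffineMap.lineMap x y t) (by
      simp only [AffineMap.lineMap_apply_module]
      fun_prop)
    have h0 := hq 0 (by simpa)
    have h1 := hq 1 (by simpa)
    rw [AffineMap.lineMap_apply_zero] at h0
    rw [AffineMap.lineMap_apply_one] at h1
    exact (JoinedIn.of_segment_subset h0).trans (JoinedIn.of_segment_subset h1).symm
  · let f : ℝ → E := fun t => (γ.extend t : E)
    have hf : Continuous f := continuous_subtype_val.comp γ.continuous_extend
    have hK : IsCompact (f '' Set.Icc 0 1) := isCompact_Icc.image hf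
    have hKY : f '' Set.Icc 0 1 ⊆ Y := by
      rintro _ ⟨t, -, rfl⟩
      exact (γ.extend t).2
    obtain ⟨ε, hε, hεY⟩ := hK.exists_thickening_subset_open hYo hKY
    obtain ⟨g', hg', hgf, -⟩ := hf.exists_contDiff_approx 1 (ε := fun _ => ε / 3)
      continuous_const fun _ => by positivity
    have hf0 : f 0 = y := by simp [f]
    have hf1 : f 1 = y := by simp [f]
    let p : ℝ → E := fun t => g' t + ((1 - t) • (y - g' 0) + t • (y - g' 1))
    have hp : ContDiff ℝ 1 p := by
      have : ContDiff ℝ 1 g' := hg'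
      fun_prop
    have hball : ∀ t ∈ Set.Icc (0 : ℝ) 1, Metric.ball (f t) ε ⊆ Y := fun t ht x hx =>
      hεY (Metric.mem_thickening_iff.2 ⟨f t, ⟨t, ht, rfl⟩, hx⟩)
    have hpf : ∀ t ∈ Set.Icc (0 : ℝ) 1, p t ∈ Metric.ball (f t) ε := by
      intro t ht
      have h0 := hgf 0
      have h1 := hgf 1
      have h2 := hgf t
      rw [hf0, dist_eq_norm, norm_sub_rev] at h0
      rw [hf1, dist_eq_norm, norm_sub_rev] at h1
      rw [dist_eq_norm] at h2
      have h3 : ‖(1 - t) • ((y : E) - g' 0) + t • ((y : E) - g' 1)‖ ≤ ε / 3 := by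
        refine (norm_add_le _ _).trans ?_
        rw [norm_smul, norm_smul, Real.norm_of_nonneg ht.1, Real.norm_of_nonneg (sub_nonneg.2 ht.2)]
        nlinarith [ht.1, ht.2]
      rw [Metric.mem_ball, dist_eq_norm]
      have h4 : p t - f t = (g' t - f t) +
        ((1 - t) • ((y : E) - g' 0) + t • ((y : E) - g' 1)) := by
        simp only [p]
        abel
      rw [h4]
      refine (norm_add_le _ _).trans_lt ?_
      linarith
    let P : Path y y :=
      { toFun := fun t => ⟨p t, hball t t.2 (hpf t t.2)⟩
        continuous_toFun := Continuous.subtype_mk (hp.continuous.comp continuous_subtype_val) _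
        source' := Subtype.ext (by simp [p])
        target' := Subtype.ext (by simp [p]) }
    have hfγ : ∀ t : I, f t = γ t := fun t => by simp [f]
    have h1 : γ.Homotopic P := Path.homotopic_of_segment_subset _ _ fun t => by
      refine ((convex_ball (f t) ε).segment_subset ?_ (hpf t t.2)).trans (hball t t.2)
      rw [← hfγ]
      exact Metric.mem_ball_self hε
    obtain ⟨q, hq⟩ := hcone hp
    exact h1.trans (P.homotopic_refl_of_cone q fun t => hq t (P t).2)

end Codimension

/-! ### The space of ordered arrangements is simply connected -/

noncomputable section OrderedSimplyConnected

open Module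

/-- The `d`-tuples of coefficient vectors of pairwise distinct lines. -/
def lineVectors (d : ℕ) : Set (Fin d → Fin 3 → ℂ) :=
  {v | (∀ i, v i ≠ 0) ∧ ∀ i j, i ≠ j → ∃ a b, v i a * v j b ≠ v j a * v i b}

theorem exists_smul_eq_of_minors {v w : Fin 3 → ℂ} (hv : v ≠ 0)
    (h : ∀ a b, w a * v b = v a * w b) : ∃ c : ℂ, c • v = w := by
  obtain ⟨b, hb⟩ := Function.ne_iff.1 hv
  refine ⟨w b / v b, funext fun a => ?_⟩
  have hb' : v b ≠ 0 := hb
  rw [Pi.smul_apply, smul_eq_mul, div_mul_eq_mul_div, div_eq_iff hb', h a b, mul_comm]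

theorem mem_lineVectors_iff {d : ℕ} {v : Fin d → Fin 3 → ℂ} (hv : ∀ i, v i ≠ 0) :
    v ∈ lineVectors d ↔ Function.Injective fun i => linePoint ⟨v i, hv i⟩ := by
  constructor
  · intro h i j hij
    by_contra hne
    obtain ⟨a, b, hab⟩ := h.2 i j hne
    obtain ⟨c, hc⟩ := linePoint_eq_iff.1 hij
    refine hab ?_
    rw [← show c • v j = v i from hc]
    simp only [Pi.smul_apply, smul_eq_mul]
    ring
  · intro h
    refine ⟨hv, fun i j hij => ?_⟩
    by_contra! hab
    exact hij (h (linePoint_eq_iff.2 (exists_smul_eq_of_minors (hv j) hab)))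

theorem isOpen_lineVectors (d : ℕ) : IsOpen (lineVectors d) := by
  have h : lineVectors d = (⋂ i, {v | v i ≠ 0}) ∩
      ⋂ (i) (j) (_ : i ≠ j), ⋃ (a) (b), {v | v i a * v j b ≠ v j a * v i b} := by
    ext v
    simp [lineVectors]
  rw [h]
  refine (isOpen_iInter_of_finite fun i => ?_).inter
    (isOpen_iInter_of_finite fun i => isOpen_iInter_of_finite fun j => isOpen_iInter_of_finite
      fun _ => isOpen_iUnion fun a => isOpen_iUnion fun b => ?_)
  · exact isOpen_ne_fun (by fun_prop) (by fun_prop)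
  · exact isOpen_ne_fun (by fun_prop) (by fun_prop)

theorem smul_mem_lineVectors {d : ℕ} {v : Fin d → Fin 3 → ℂ} (hv : v ∈ lineVectors d)
    {c : Fin d → ℂ} (hc : ∀ i, c i ≠ 0) : (fun i => c i • v i) ∈ lineVectors d := by
  refine ⟨fun i => smul_ne_zero (hc i) (hv.1 i), fun i j hij => ?_⟩
  obtain ⟨a, b, hab⟩ := hv.2 i j hij
  refine ⟨a, b, fun h => hab (mul_left_cancel₀ (mul_ne_zero (hc i) (hc j)) ?_)⟩
  simp only [Pi.smul_apply, smul_eq_mul] at h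
  linear_combination h

/-- A parametrization of the tuples whose entry `i` vanishes or is a multiple of another entry. -/
def degenerateTuples {d : ℕ} (k : Σ i : Fin d, Option {j // j ≠ i})
    (z : ({j // j ≠ k.1} → Fin 3 → ℂ) × ℂ) : Fin d → Fin 3 → ℂ := fun l =>
  if h : l = k.1 then z.2 • k.2.elim 0 z.1 else z.1 ⟨l, h⟩

theorem contDiff_degenerateTuples {d : ℕ} (k : Σ i : Fin d, Option {j // j ≠ i}) :
    ContDiff ℝ 1 (degenerateTuples k) := by
  refine contDiff_pi.2 fun l => ?_
  obtain ⟨i, j⟩ := k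
  by_cases h : l = i
  · cases j with
    | none => simpa [degenerateTuples, h] using contDiff_const
    | some j =>
      simp only [degenerateTuples, h, dite_true, Option.elim]
      fun_prop
  · simp only [degenerateTuples, h, dite_false]
    fun_prop

theorem compl_lineVectors_subset (d : ℕ) :
    (lineVectors d)ᶜ ⊆ ⋃ k, Set.range (degenerateTuples (d := d) k) := by
  intro v hv
  by_cases h0 : ∀ i, v i ≠ 0
  · rw [Set.mem_compl_iff, mem_lineVectors_iff h0, Function.Injective] at hv
    push Not at hv
    obtain ⟨i, j, hij, hne⟩ := hv
    obtain ⟨c, hc⟩ := linePoint_eq_iff.1 hij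
    refine Set.mem_iUnion.2 ⟨⟨i, some ⟨j, hne.symm⟩⟩, (fun l => v l, c), funext fun l => ?_⟩
    by_cases h : l = i
    · subst h
      simpa [degenerateTuples] using hc
    · simp [degenerateTuples, h]
  · push Not at h0
    obtain ⟨i, hi⟩ := h0
    refine Set.mem_iUnion.2 ⟨⟨i, none⟩, (fun l => v l, 0), funext fun l => ?_⟩
    by_cases h : l = i
    · subst h
      simp [degenerateTuples, hi]
    · simp [degenerateTuples, h]

/-- The lines with given coefficients. -/
def linesOfVectors (d : ℕ) : C(lineVectors d, orderedArrangementSpace d) where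
  toFun v := ⟨fun i => linePoint ⟨v.1 i, v.2.1 i⟩, (mem_lineVectors_iff v.2.1).1 v.2⟩
  continuous_toFun := by
    refine Continuous.subtype_mk (continuous_pi fun i => ?_) _
    exact isOpenQuotientMap_linePoint.continuous.comp (Continuous.subtype_mk
      ((continuous_apply i).comp continuous_subtype_val) _)

theorem linesOfVectors_eq_iff {d : ℕ} {v w : lineVectors d} :
    linesOfVectors d v = linesOfVectors d w ↔ ∀ i, ∃ c : ℂ, c • w.1 i = v.1 i := by
  rw [Subtype.ext_iff, funext_iff]
  exact forall_congr' fun i => linePoint_eq_iff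

theorem simplyConnectedSpace_lineVectors {d : ℕ} (hd : 1 ≤ d)
    (hne : (orderedArrangementSpace d).Nonempty) : SimplyConnectedSpace (lineVectors d) := by
  have hE : finrank ℝ (Fin d → Fin 3 → ℂ) = d * 6 := by
    simp [finrank_pi_fintype, Complex.finrank_real_complex]
  have hF : ∀ k : Σ i : Fin d, Option {j // j ≠ i},
      finrank ℝ (({j // j ≠ k.1} → Fin 3 → ℂ) × ℂ) = (d - 1) * 6 + 2 := by
    intro k
    rw [finrank_prod, finrank_pi_fintype]
    simp [finrank_pi_fintype, Complex.finrank_real_complex]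
  refine simplyConnectedSpace_of_codimension (isOpen_lineVectors d) ?_ contDiff_degenerateTuples
    (by omega) (fun k => ?_) (compl_lineVectors_subset d)
  · obtain ⟨l, hl⟩ := hne
    choose c hc using fun i => isOpenQuotientMap_linePoint.surjective (l i)
    refine ⟨fun i => c i, (mem_lineVectors_iff fun i => (c i).2).2 ?_⟩
    simp only [Subtype.coe_eta, hc]
    exact hl
  · rw [hE, hF]
    omega

theorem exists_path_of_linesOfVectors_eq {d : ℕ} {v w : lineVectors d}
    (h : linesOfVectors d v = linesOfVectors d w) :
    ∃ γ : Path v w, ∀ t, linesOfVectors d (γ t) = linesOfVectors d v := by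
  choose c hc using linesOfVectors_eq_iff.1 h.symm
  have hc0 : ∀ i, c i ≠ 0 := fun i hi => w.2.1 i (by rw [← hc, hi, zero_smul])
  refine ⟨{ toFun := fun t => ⟨fun i => Complex.exp ((t : ℝ) * Complex.log (c i)) • v.1 i,
              smul_mem_lineVectors v.2 fun i => Complex.exp_ne_zero _⟩
            continuous_toFun := Continuous.subtype_mk (by fun_prop) _
            source' := Subtype.ext (funext fun i => by simp)
            target' := Subtype.ext (funext fun i => by simp [Complex.exp_log (hc0 i), hc]) },
    fun t => linesOfVectors_eq_iff.2 fun i => ⟨_, rfl⟩⟩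

/-- The coefficients of a line. -/
def lineCoeffs (x : ℙ ℂ (ternaryForms 1)) : Fin 3 → ℂ := linForm.symm x.rep

theorem lineCoeffs_ne_zero (x : ℙ ℂ (ternaryForms 1)) : lineCoeffs x ≠ 0 :=
  linForm.symm.map_ne_zero_iff.2 x.rep_nonzero

theorem linePoint_lineCoeffs (x : ℙ ℂ (ternaryForms 1)) :
    linePoint ⟨lineCoeffs x, lineCoeffs_ne_zero x⟩ = x := by
  simp only [linePoint, lineCoeffs, LinearEquiv.apply_symm_apply, Projectivization.mk_rep]

theorem exists_lineCoeffs_linePoint (c : {c : Fin 3 → ℂ // c ≠ 0}) :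
    ∃ a : ℂ, a ≠ 0 ∧ lineCoeffs (linePoint c) = a • c.1 := by
  obtain ⟨a, ha, h⟩ := exists_rep_mk_eq_smul (linForm c.1) (linForm.map_ne_zero_iff.2 c.2)
  exact ⟨a, ha, by rw [lineCoeffs, linePoint, h, map_smul, LinearEquiv.symm_apply_apply]⟩

theorem isOpen_lineCoeffs_ne_zero (a : Fin 3) :
    IsOpen {x : ℙ ℂ (ternaryForms 1) | lineCoeffs x a ≠ 0} := by
  rw [← isOpenQuotientMap_linePoint.isQuotientMap.isOpen_preimage]
  have h : linePoint ⁻¹' {x | lineCoeffs x a ≠ 0} = {c | c.1 a ≠ 0} := by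
    ext c
    obtain ⟨b, hb, h⟩ := exists_lineCoeffs_linePoint c
    simp [h, hb]
  rw [h]
  exact isOpen_ne_fun ((continuous_apply a).comp continuous_subtype_val) continuous_const

theorem continuousOn_normalized_lineCoeffs (a : Fin 3) :
    ContinuousOn (fun x => (lineCoeffs x a)⁻¹ • lineCoeffs x)
      {x : ℙ ℂ (ternaryForms 1) | lineCoeffs x a ≠ 0} := by
  intro x hx
  obtain ⟨c, rfl⟩ := isOpenQuotientMap_linePoint.surjective x
  refine ContinuousAt.continuousWithinAt ?_
  rw [← isOpenQuotientMap_linePoint.continuousAt_comp_iff]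
  have h : (fun x => (lineCoeffs x a)⁻¹ • lineCoeffs x) ∘ linePoint =
      fun c => (c.1 a)⁻¹ • c.1 := by
    ext1 c
    obtain ⟨b, hb, h⟩ := exists_lineCoeffs_linePoint c
    simp only [Function.comp_apply, h, Pi.smul_apply, smul_eq_mul, smul_smul, mul_inv]
    rw [mul_right_comm, inv_mul_cancel₀ hb, one_mul]
  rw [h]
  obtain ⟨b, hb, h⟩ := exists_lineCoeffs_linePoint c
  have hc : c.1 a ≠ 0 := by
    rw [Set.mem_ofPred_eq, h] at hx
    exact right_ne_zero_of_mul hx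
  have h1 : Continuous fun c : {c : Fin 3 → ℂ // c ≠ 0} => c.1 a :=
    (continuous_apply a).comp continuous_subtype_val
  exact (h1.continuousAt.inv₀ hc).smul continuous_subtype_val.continuousAt

theorem exists_local_section_linesOfVectors {d : ℕ} (x : orderedArrangementSpace d) :
    ∃ U : Set (orderedArrangementSpace d), IsOpen U ∧ x ∈ U ∧
      ∃ s : orderedArrangementSpace d → lineVectors d, ContinuousOn s U ∧
        ∀ z ∈ U, linesOfVectors d (s z) = z := by
  classical
  choose a ha using fun i => Function.ne_iff.1 (lineCoeffs_ne_zero (x.1 i))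
  let S : orderedArrangementSpace d → Fin d → Fin 3 → ℂ := fun z i =>
    (lineCoeffs (z.1 i) (a i))⁻¹ • lineCoeffs (z.1 i)
  let U : Set (orderedArrangementSpace d) := {z | ∀ i, lineCoeffs (z.1 i) (a i) ≠ 0}
  have hU : IsOpen U := by
    have h : U = ⋂ i, {z : orderedArrangementSpace d | lineCoeffs (z.1 i) (a i) ≠ 0} :=
      Set.ofPred_forall _
    rw [h]
    refine isOpen_iInter_of_finite fun i => ?_
    have hc : Continuous fun z : orderedArrangementSpace d => z.1 i :=
      (continuous_apply i).comp continuous_subtype_val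
    exact (isOpen_lineCoeffs_ne_zero (a i)).preimage hc
  have hcoeff : ∀ z : orderedArrangementSpace d, (fun i => lineCoeffs (z.1 i)) ∈ lineVectors d := by
    intro z
    rw [mem_lineVectors_iff fun i => lineCoeffs_ne_zero _]
    simp only [linePoint_lineCoeffs]
    exact z.2
  have hS : ∀ z ∈ U, S z ∈ lineVectors d := fun z hz =>
    smul_mem_lineVectors (hcoeff z) fun i => inv_ne_zero (hz i)
  let s : orderedArrangementSpace d → lineVectors d := fun z =>
    if hz : z ∈ U then ⟨S z, hS z hz⟩ else ⟨_, hcoeff z⟩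
  have hs : ∀ z ∈ U, (s z : Fin d → Fin 3 → ℂ) = S z := fun z hz => by simp [s, hz]
  refine ⟨U, hU, ha, s, ?_, fun z hz => ?_⟩
  · rw [Topology.IsInducing.subtypeVal.continuousOn_iff]
    refine ContinuousOn.congr (f := S) (continuousOn_pi.2 fun i => ?_) hs
    exact (continuousOn_normalized_lineCoeffs (a i)).comp
      ((continuous_apply i).comp continuous_subtype_val).continuousOn fun z hz => hz i
  · refine Subtype.ext (funext fun i => ?_)
    refine Eq.trans ?_ (linePoint_lineCoeffs (z.1 i))
    exact linePoint_eq_iff.2 ⟨(lineCoeffs (z.1 i) (a i))⁻¹, (congrFun (hs z hz) i).symm⟩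

theorem simplyConnectedSpace_orderedArrangementSpace {d : ℕ} (hd : 1 ≤ d) :
    SimplyConnectedSpace (orderedArrangementSpace d) := by
  have := simplyConnectedSpace_lineVectors hd (isSmoothIrreducibleVariety_ordered d).isIrreducible.1
  exact simplyConnectedSpace_of_local_sections (linesOfVectors d)
    (fun _ _ => exists_path_of_linesOfVectors_eq) exists_local_section_linesOfVectors

end OrderedSimplyConnected

theorem corollary2p2 (d : ℕ) (hd : 1 ≤ d) :
    IsSmoothIrreducibleVariety (projForms (ternaryForms d)) (arrangementSpace d) (2 * d) ∧
    IsSmoothIrreducibleVariety (multiprojForms fun _ : Fin d => ternaryForms 1)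
      (orderedArrangementSpace d) (2 * d) ∧
    SimplyConnectedSpace (orderedArrangementSpace d) ∧
    ∀ f : arrangementSpace d,
      Nonempty (FundamentalGroup (arrangementSpace d) f ≃* Equiv.Perm (Fin d)) := by
  have h := simplyConnectedSpace_orderedArrangementSpace hd
  exact ⟨isSmoothIrreducibleVariety_arrangement d, isSmoothIrreducibleVariety_ordered d, h,
    nonempty_fundamentalGroup_mulEquiv d⟩
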